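/- Let $d\ge 1$, let $\mathbb{B}^d=\{z\in\mathbb{C}^d:|z|<1\}$, let $\lambda>0$, and let $k\ge 0$ be any integer with $\lambda+2k>d$. For $\sigma>d$ let $\mu_\sigma$ be the measure on $\mathbb{B}^d$ $$d\mu_\sigma(z)=\frac{\Gamma(\sigma)}{\pi^d\,\Gamma(\sigma-d)}\,(1-|z|^2)^{\sigma-d-1}\,dz ,$$ where $dz$ is $2d$-dimensional Lebesgue measure, and let $N=\sum_{j=1}^d z_j\,\partial/\partial z_j$. Let $H(\mathbb{B}^d,\lambda)$ be the space of holomorphic functions $f$ on $\mathbb{B}^d$ such that $N^l f\in L^2(\mathbb{B}^d,\mu_{\lambda+2k})$ for $0\le l\le k$, with the form (conjugate-linear in $f$) $$\langle f,g\rangle_\lambda=\langle Af,Bg\rangle_{L^2(\mu_{\lambda+2k})},\qquad A=\prod_{i=0}^{k-1}\Bigl(I+\frac{N}{\lambda+k+i}\Bigr),\quad B=\prod_{i=0}^{k-1}\Bigl(I+\frac{N}{\lambda+i}\Bigr).$$ Then $\langle\cdot,\cdot\rangle_\lambda$ is an inner product for which $H(\mathbb{B}^d,\lambda)$ is a Hilbert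 space, and: 1. For every multi-index $n$, multiplication by $z^n$ maps $H(\mathbb{B}^d,\lambda)$ into itself and is a bounded operator $M_{z^n}$. 2. For every $j\in\{1,\dots,d\}$, $\|M_{z_j}\|=1$ if $\lambda\ge 1$, and $\|M_{z_j}\|=1/\sqrt{\lambda}$ if $\lambda<1$. 3. For every polynomial $\phi=\sum_{m,n}c_{m,n}\,\bar z^m z^n$ (a finite sum, $c_{m,n}\in\mathbb{C}$), the Toeplitz operator $T_\phi=\sum_{m,n}c_{m,n}\,(M_{z^m})^{*}M_{z^n}$ is a bounded operator on $H(\mathbb{B}^d,\lambda)$. -/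

import Mathlib

open MeasureTheory

noncomputable section

namespace GenBergman

/-- The square `|z|² = ∑ |z_j|²` of the Euclidean norm on `ℂ^d`. -/
def normSqC {d : ℕ} (z : Fin d → ℂ) : ℝ := ∑ j, ‖z j‖ ^ 2

/-- The open Euclidean unit ball `𝔹^d` of `ℂ^d`. (The norm that Mathlib puts on `Fin d → ℂ` is the
sup norm, so the ball is written out; `volume` on `Fin d → ℂ` is `2d`-dimensional Lebesgue
measure.) -/
def unitBall (d : ℕ) : Set (Fin d → ℂ) := {z | normSqC z < 1}

theorem isOpen_unitBall (d : ℕ) : IsOpen (unitBall d) := by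
  unfold unitBall normSqC
  exact isOpen_lt (by fun_prop) continuous_const

/-- The monomial `z^n = ∏ z_j ^ n_j`. -/
def monomialFun {d : ℕ} (n : Fin d → ℕ) (z : Fin d → ℂ) : ℂ := ∏ j, z j ^ n j

/-- The hyperbolic volume measure `dτ = (1 - |z|²)^{-(d+1)} dz` on the ball. -/
def hyperbolicMeasure (d : ℕ) : Measure (Fin d → ℂ) :=
  (volume.restrict (unitBall d)).withDensity
    fun z => ENNReal.ofReal ((1 - normSqC z) ^ (-((d : ℝ) + 1)))

/-- The normalizing constant `c_σ = Γ(σ) / (π^d Γ(σ - d))`, used for `σ > d`. -/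
def normConst (d : ℕ) (σ : ℝ) : ℝ := Real.Gamma σ / (Real.pi ^ d * Real.Gamma (σ - d))

/-- The measure `dμ_σ = c_σ (1 - |z|²)^σ dτ`; a probability measure on the ball if `σ > d`. -/
def bergmanMeasure (d : ℕ) (σ : ℝ) : Measure (Fin d → ℂ) :=
  (hyperbolicMeasure d).withDensity
    fun z => ENNReal.ofReal (normConst d σ * (1 - normSqC z) ^ σ)

/-- The space of holomorphic functions on the ball. A function on the ball is represented by its
extension by zero to `ℂ^d`, so that equality in this space is equality on the ball. -/
def Hol (d : ℕ) : Submodule ℂ ((Fin d → ℂ) → ℂ) where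
  carrier := {f | AnalyticOnNhd ℂ f (unitBall d) ∧ ∀ z ∉ unitBall d, f z = 0}
  add_mem' := by
    rintro f g ⟨hf, hf'⟩ ⟨hg, hg'⟩
    exact ⟨hf.add hg, fun z hz => by simp [hf' z hz, hg' z hz]⟩
  zero_mem' := ⟨analyticOnNhd_const, fun _ _ => rfl⟩
  smul_mem' := by
    rintro c f ⟨hf, hf'⟩
    exact ⟨fun z hz => analyticAt_const.smul (hf z hz), fun z hz => by simp [hf' z hz]⟩

open Classical in
/-- The function `∑ z_j ∂f/∂z_j` on the ball, extended by zero. -/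
def numberFun {d : ℕ} (f : (Fin d → ℂ) → ℂ) (z : Fin d → ℂ) : ℂ :=
  if z ∈ unitBall d then ∑ j, z j * fderiv ℂ f z (Pi.single j 1) else 0

theorem numberFun_mem {d : ℕ} {f : (Fin d → ℂ) → ℂ} (hf : f ∈ Hol d) : numberFun f ∈ Hol d := by
  refine ⟨?_, fun z hz => by simp [numberFun, hz]⟩
  intro z hz
  have h1 : AnalyticAt ℂ (fun w : Fin d → ℂ => ∑ j, w j * fderiv ℂ f w (Pi.single j 1)) z := by
    refine Finset.analyticAt_fun_sum _ fun j _ => ?_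
    refine AnalyticAt.mul ((ContinuousLinearMap.proj (R := ℂ) j).analyticAt z) ?_
    exact ((ContinuousLinearMap.apply ℂ ℂ
      (Pi.single j (1 : ℂ) : Fin d → ℂ)).analyticAt _).comp (hf.1.fderiv z hz)
  refine h1.congr ?_
  filter_upwards [(isOpen_unitBall d).mem_nhds hz] with w hw
  simp [numberFun, hw]

/-- The number operator `N = ∑ z_j ∂/∂z_j` on holomorphic functions. -/
def numberOp (d : ℕ) : Module.End ℂ (Hol d) where
  toFun f := ⟨numberFun f.1, numberFun_mem f.2⟩
  map_add' := by
    intro f g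
    ext z
    by_cases hz : z ∈ unitBall d
    · have hf := (f.2.1 z hz).differentiableAt
      have hg := (g.2.1 z hz).differentiableAt
      simp [numberFun, hz, fderiv_add hf hg, mul_add, Finset.sum_add_distrib]
    · simp [numberFun, hz]
  map_smul' := by
    intro c f
    ext z
    by_cases hz : z ∈ unitBall d
    · have hf := (f.2.1 z hz).differentiableAt
      simp [numberFun, hz, fderiv_const_smul hf, Finset.mul_sum, mul_left_comm]
    · simp [numberFun, hz]

/-- The operator `(I + N/a) (I + N/(a+1)) ⋯ (I + N/(a+k-1))` on holomorphic functions. -/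
def shiftOp (d : ℕ) (a : ℝ) (k : ℕ) : Module.End ℂ (Hol d) :=
  ((List.range k).map fun i => 1 + (((a + i)⁻¹ : ℝ) : ℂ) • numberOp d).prod

/-- The subspace of the holomorphic functions `f` with `N^l f ∈ L²(μ_{λ+2k})` for `0 ≤ l ≤ k`. -/
def sobolevSubmodule (d : ℕ) (lam : ℝ) (k : ℕ) : Submodule ℂ (Hol d) where
  carrier := {f | ∀ l ≤ k, MemLp ((numberOp d ^ l) f).1 2 (bergmanMeasure d (lam + 2 * k))}
  add_mem' := by
    intro f g hf hg l hl
    rw [map_add]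
    exact (hf l hl).add (hg l hl)
  zero_mem' := by
    intro l _
    rw [map_zero]
    exact MemLp.zero
  smul_mem' := by
    intro c f hf l hl
    rw [map_smul]
    exact (hf l hl).const_smul c

/-- The generalized Bergman space `H(𝔹^d, λ)`, described with `k` derivatives, where
`λ + 2k > d`. It is a type of its own, so that it does not inherit the topology of pointwise
convergence. -/
def BergmanSpace (d : ℕ) (lam : ℝ) (k : ℕ) : Type := sobolevSubmodule d lam k

instance (d : ℕ) (lam : ℝ) (k : ℕ) : AddCommGroup (BergmanSpace d lam k) :=
  inferInstanceAs (AddCommGroup (sobolevSubmodule d lam k))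

instance (d : ℕ) (lam : ℝ) (k : ℕ) : Module ℂ (BergmanSpace d lam k) :=
  inferInstanceAs (Module ℂ (sobolevSubmodule d lam k))

/-- The underlying holomorphic function. -/
def BergmanSpace.toHol {d : ℕ} {lam : ℝ} {k : ℕ} (f : BergmanSpace d lam k) : Hol d :=
  Subtype.val (p := fun x => x ∈ sobolevSubmodule d lam k) f

instance (d : ℕ) (lam : ℝ) (k : ℕ) :
    CoeFun (BergmanSpace d lam k) fun _ => (Fin d → ℂ) → ℂ where
  coe f := f.toHol.1

/-- The form `⟨f, g⟩_λ = ⟨A f, B g⟩` in `L²(μ_{λ+2k})`, conjugate-linear in `f`, where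
`A = (I + N/(λ+k)) ⋯ (I + N/(λ+2k-1))` and `B = (I + N/λ) ⋯ (I + N/(λ+k-1))`. -/
def sobolevInner {d : ℕ} {lam : ℝ} {k : ℕ} (f g : BergmanSpace d lam k) : ℂ :=
  ∫ z, (starRingEnd ℂ) ((shiftOp d (lam + k) k f.toHol).1 z) * (shiftOp d lam k g.toHol).1 z
    ∂(bergmanMeasure d (lam + 2 * k))

/-- A polynomial symbol `φ = ∑ c_{m,n} z̄^m z^n` is a polynomial in the `2d` variables
`z̄_1, …, z̄_d` (index `Sum.inl`) and `z_1, …, z_d` (index `Sum.inr`). Given the multiplication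
operators `M n = M_{z^n}` on a Hilbert space `H`, its Toeplitz operator is
`T_φ = ∑ c_{m,n} (M_{z^m})^* M_{z^n}`. -/
def toeplitz {d : ℕ} {H : Type*} [NormedAddCommGroup H] [InnerProductSpace ℂ H] [CompleteSpace H]
    (M : (Fin d → ℕ) → (H →L[ℂ] H)) (φ : MvPolynomial (Fin d ⊕ Fin d) ℂ) (f : H) : H :=
  ∑ s ∈ φ.support, φ.coeff s •
    ContinuousLinearMap.adjoint (M fun j => s (Sum.inl j)) (M (fun j => s (Sum.inr j)) f)

end GenBergman

end

noncomputable section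

namespace GenBergman

/-! In Taylor coefficients every object is diagonal or a weighted shift. For `σ > d` the measure
`μ_σ` is invariant under the torus acting on the coordinates. Averaging over the torus and Parseval
give `∫ |f|² dμ_σ = ∑ |a_n|² w_σ(n)` with `w_σ(n) = n! Γ(σ) / Γ(σ + |n|)` (`lintegral_hol_sq`); the
weight is a Dirichlet integral.

`N` multiplies `a_n` by `|n|`, so `A` and `B` are diagonal. The functional equation of `Γ` says that
the product of their eigenvalues is exactly `w_λ(n) / w_{λ+2k}(n)` (`weight_eq_mul_mul`). Hence `⟨f,
g⟩_λ = ∑ conj(a_n) b_n w_λ(n)`, which no longer involves `k`. As each eigenvalue is comparable to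
`max(1, |n|)^k`, the condition on the `N^l f` is equivalent to `∑ |a_n|² w_λ(n) < ∞`
(`mem_sobolevSubmodule_iff`). Every such sequence comes from a holomorphic function, since `∑ |z^n|²
/ w_λ(n)` is finite on the ball. So the space is a weighted `ℓ²`, hence complete.

Multiplication by `z_j` shifts `n` to `n + e_j` and scales squared norms by `w_λ(n + e_j) / w_λ(n) =
(n_j + 1) / (λ + |n|)`. The supremum of this ratio is already that over the powers `z_j^m`, where it
equals `(m + 1) / (λ + m)`: it is `1`, the limit, if `λ ≥ 1`, and `1/λ`, the value at `m = 0`, if `λ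
< 1`. Monomials act by compositions of coordinate multiplications, and Toeplitz operators are finite
sums of products of bounded operators. -/

/-! ### Parseval's identity on the torus -/

theorem hasSum_norm_sq_of_orthonormal {ι E : Type*} [NormedAddCommGroup E]
    [InnerProductSpace ℂ E] {v : ι → E} (hv : Orthonormal ℂ v) {b : ι → ℂ} {x : E}
    (hx : HasSum (fun n => b n • v n) x) : HasSum (fun n => ‖b n‖ ^ 2) (‖x‖ ^ 2) := by
  classical
  have h1 : ∀ k, inner ℂ (v k) x = b k := fun k => by
    have := hx.mapL (innerSL ℂ (v k))
    simp only [innerSL_apply_apply, inner_smul_right, orthonormal_iff_ite.mp hv] at this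
    exact this.unique (by
      convert hasSum_single k fun j hj => ?_ using 1 <;> grind)
  have h2 := hx.mapL (innerSL ℂ x)
  simp only [innerSL_apply_apply, inner_smul_right] at h2
  have h3 : ∀ n, b n * inner ℂ x (v n) = ((‖b n‖ ^ 2 : ℝ) : ℂ) := fun n => by
    rw [← inner_conj_symm, h1, Complex.mul_conj, Complex.normSq_eq_norm_sq]
  simp only [h3, inner_self_eq_norm_sq_to_K] at h2
  have h4 := Complex.hasSum_re h2
  simpa [← Complex.ofReal_pow] using h4

/-- Normalized Haar measure on the torus. -/
def torusMeasure (d : ℕ) : Measure (UnitAddTorus (Fin d)) :=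
  Measure.pi fun _ => AddCircle.haarAddCircle

instance (d : ℕ) : IsProbabilityMeasure (torusMeasure d) := by
  unfold torusMeasure; infer_instance

/-- The character of the torus with exponent `n`. -/
abbrev torusChar {d : ℕ} (n : Fin d → ℕ) : C(UnitAddTorus (Fin d), ℂ) :=
  UnitAddTorus.mFourier fun j => (n j : ℤ)

theorem orthonormal_torusChar (d : ℕ) : Orthonormal ℂ fun n : Fin d → ℕ =>
    ContinuousMap.toLp (E := ℂ) 2 (torusMeasure d) ℂ (torusChar n) := by
  classical
  rw [orthonormal_iff_ite]
  intro m n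
  simp only [ContinuousMap.inner_toLp, ← UnitAddTorus.mFourier_neg, ← UnitAddTorus.mFourier_add]
  split_ifs with h
  · simp [h, UnitAddTorus.mFourier_zero]
  simp only [UnitAddTorus.mFourier, ContinuousMap.coe_mk, torusMeasure]
  rw [MeasureTheory.integral_fintype_prod_eq_prod]
  obtain ⟨i, hi⟩ := Function.ne_iff.mp h
  apply Finset.prod_eq_zero (Finset.mem_univ i)
  have h1 := (orthonormal_iff_ite.mp <| orthonormal_fourier (T := 1)) (m i) (n i)
  rw [if_neg (by exact_mod_cast hi), ContinuousMap.inner_toLp] at h1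
  simp only [← fourier_neg, ← fourier_add] at h1
  exact h1

/-- Absolute summability makes the Fourier series converge uniformly, hence in `L²`, where Parseval
applies. The form in `ENNReal` allows Tonelli later without integrability conditions. -/
theorem lintegral_torus_sq {d : ℕ} {b : (Fin d → ℕ) → ℂ} (hb : Summable b)
    {F : UnitAddTorus (Fin d) → ℂ} (hF : ∀ θ, HasSum (fun n => b n * torusChar n θ) (F θ)) :
    ∫⁻ θ, ‖F θ‖ₑ ^ 2 ∂(torusMeasure d) = ∑' n, ‖b n‖ₑ ^ 2 := by
  have hs : Summable fun n => b n • torusChar n := by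
    refine .of_norm ?_
    simpa only [norm_smul, UnitAddTorus.mFourier_norm, mul_one] using hb.norm
  obtain ⟨G, hG⟩ := hs
  have hGF : ∀ θ, G θ = F θ := fun θ => by
    refine HasSum.unique ?_ (hF θ)
    simpa using hG.mapL (ContinuousMap.evalCLM ℂ θ)
  have h1 := hG.mapL (ContinuousMap.toLp (E := ℂ) 2 (torusMeasure d) ℂ)
  simp only [map_smul] at h1
  have h2 := hasSum_norm_sq_of_orthonormal (orthonormal_torusChar d) h1
  have h3 : ∫⁻ θ, ‖F θ‖ₑ ^ 2 ∂(torusMeasure d) = ENNReal.ofReal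
      (‖ContinuousMap.toLp (E := ℂ) 2 (torusMeasure d) ℂ G‖ ^ 2) := by
    rw [ENNReal.ofReal_pow (norm_nonneg _), ofReal_norm, Lp.enorm_def,
      eLpNorm_congr_ae (ContinuousMap.coeFn_toLp _ G), ← ENNReal.rpow_natCast]
    have := eLpNorm_nnreal_pow_eq_lintegral (μ := torusMeasure d) (f := G) (p := 2) (by norm_num)
    simp only [NNReal.coe_ofNat, ENNReal.coe_ofNat] at this
    simpa [hGF] using this.symm
  rw [h3, ← h2.tsum_eq, ENNReal.ofReal_tsum_of_nonneg (fun _ => by positivity) h2.summable]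
  simp [ENNReal.ofReal_pow, ofReal_norm]

/-! ### The torus action and the geometry of the ball -/

/-- The action of the torus on `ℂ^d`. -/
def rotate {d : ℕ} (θ : UnitAddTorus (Fin d)) (z : Fin d → ℂ) : Fin d → ℂ :=
  fun j => fourier 1 (θ j) * z j

theorem norm_rotate_apply {d : ℕ} (θ : UnitAddTorus (Fin d)) (z : Fin d → ℂ) (j : Fin d) :
    ‖rotate θ z j‖ = ‖z j‖ := by
  rw [rotate, norm_mul, fourier_apply, Circle.norm_coe, one_mul]

theorem normSqC_rotate {d : ℕ} (θ : UnitAddTorus (Fin d)) (z : Fin d → ℂ) :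
    normSqC (rotate θ z) = normSqC z := by
  simp [normSqC, norm_rotate_apply]

theorem monomialFun_rotate {d : ℕ} (n : Fin d → ℕ) (θ : UnitAddTorus (Fin d)) (z : Fin d → ℂ) :
    monomialFun n (rotate θ z) = monomialFun n z * torusChar n θ := by
  simp only [monomialFun, rotate, mul_pow, Finset.prod_mul_distrib, UnitAddTorus.mFourier,
    ContinuousMap.coe_mk]
  rw [mul_comm]
  congr 1
  refine Finset.prod_congr rfl fun j _ => ?_
  simp [fourier_apply, ← Circle.coe_pow, AddCircle.toCircle_nsmul]

/-- Along a torus orbit a power series is a Fourier series, so the cross terms average out. This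
single identity yields the coefficient estimates, the uniqueness of expansions and the `L²` norms.
-/
theorem lintegral_rotate_sq {d : ℕ} {a : (Fin d → ℕ) → ℂ} {f : (Fin d → ℂ) → ℂ} {z : Fin d → ℂ}
    (hz : Summable fun n => a n * monomialFun n z)
    (hf : ∀ θ, HasSum (fun n => a n * monomialFun n (rotate θ z)) (f (rotate θ z))) :
    ∫⁻ θ, ‖f (rotate θ z)‖ₑ ^ 2 ∂(torusMeasure d) = ∑' n, ‖a n * monomialFun n z‖ₑ ^ 2 := by
  refine lintegral_torus_sq hz fun θ => ?_
  simpa only [monomialFun_rotate, mul_assoc] using hf θ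

theorem normSqC_smul {d : ℕ} (t : ℂ) (z : Fin d → ℂ) : normSqC (t • z) = ‖t‖ ^ 2 * normSqC z := by
  simp [normSqC, mul_pow, Finset.mul_sum]

theorem normSqC_nonneg {d : ℕ} (z : Fin d → ℂ) : 0 ≤ normSqC z :=
  Finset.sum_nonneg fun _ _ => by positivity

theorem mem_unitBall_of_norm_le {d : ℕ} {z w : Fin d → ℂ} (hz : z ∈ unitBall d)
    (h : ∀ j, ‖w j‖ ≤ ‖z j‖) : w ∈ unitBall d :=
  lt_of_le_of_lt (Finset.sum_le_sum fun j _ => pow_le_pow_left₀ (norm_nonneg _) (h j) 2) hz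

theorem smul_mem_unitBall {d : ℕ} {z : Fin d → ℂ} (hz : z ∈ unitBall d) {t : ℂ} (ht : ‖t‖ ≤ 1) :
    t • z ∈ unitBall d :=
  mem_unitBall_of_norm_le hz fun j => by
    simpa using mul_le_of_le_one_left (norm_nonneg (z j)) ht

theorem rotate_mem_unitBall {d : ℕ} {z : Fin d → ℂ} (hz : z ∈ unitBall d)
    (θ : UnitAddTorus (Fin d)) : rotate θ z ∈ unitBall d :=
  mem_unitBall_of_norm_le hz fun j => (norm_rotate_apply θ z j).le

theorem zero_mem_unitBall (d : ℕ) : (0 : Fin d → ℂ) ∈ unitBall d := by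
  simp [unitBall, normSqC]

theorem exists_one_lt_smul_mem_unitBall {d : ℕ} {z : Fin d → ℂ} (hz : z ∈ unitBall d) :
    ∃ r : ℝ, 1 < r ∧ (r : ℂ) • z ∈ unitBall d := by
  have hS : normSqC z < 1 := hz
  have hS0 := normSqC_nonneg z
  -- With `S = |z|² < 1`, both `2 / (1 + S) > 1` and `2S / (1 + S) < 1` hold.
  refine ⟨√(2 / (1 + normSqC z)), ?_, ?_⟩
  · rw [Real.lt_sqrt zero_le_one, lt_div_iff₀ (by linarith)]
    linarith
  · have h2 : (0 : ℝ) ≤ 2 / (1 + normSqC z) := by positivity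
    show normSqC _ < 1
    rw [normSqC_smul, Complex.norm_real, Real.norm_eq_abs, sq_abs, Real.sq_sqrt h2,
      div_mul_eq_mul_div, div_lt_one (by linarith)]
    linarith

theorem monomialFun_smul {d : ℕ} (n : Fin d → ℕ) (t : ℂ) (z : Fin d → ℂ) :
    monomialFun n (t • z) = t ^ (∑ j, n j) * monomialFun n z := by
  simp [monomialFun, mul_pow, Finset.prod_mul_distrib, Finset.prod_pow_eq_pow_sum]

theorem norm_monomialFun {d : ℕ} (n : Fin d → ℕ) (z : Fin d → ℂ) :
    ‖monomialFun n z‖ = ∏ j, ‖z j‖ ^ n j := by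
  simp [monomialFun]

/-! ### Homogeneous expansion along complex lines -/

theorem exists_bound_on_polydisc {d : ℕ} {f : (Fin d → ℂ) → ℂ} (hf : f ∈ Hol d) {z : Fin d → ℂ}
    (hz : z ∈ unitBall d) : ∃ C, ∀ w : Fin d → ℂ, (∀ j, ‖w j‖ ≤ ‖z j‖) → ‖f w‖ ≤ C := by
  have hK : IsCompact (Set.univ.pi fun j => Metric.closedBall (0 : ℂ) ‖z j‖) :=
    isCompact_univ_pi fun j => isCompact_closedBall _ _
  obtain ⟨C, hC⟩ := hK.exists_bound_of_continuousOn (f := f) fun w hw =>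
    (hf.1 w (mem_unitBall_of_norm_le hz fun j => by
      simpa using hw j trivial)).continuousAt.continuousWithinAt
  exact ⟨C, fun w hw => hC w fun j _ => by simpa using hw j⟩

theorem differentiableOn_slice {d : ℕ} {f : (Fin d → ℂ) → ℂ} (hf : f ∈ Hol d) {z : Fin d → ℂ}
    (hz : z ∈ unitBall d) : DifferentiableOn ℂ (fun t : ℂ => f (t • z)) (Metric.closedBall 0 1) := by
  intro t ht
  have h1 := (hf.1 (t • z) (smul_mem_unitBall hz (by simpa using ht))).differentiableAt
  exact (h1.comp t (by fun_prop : DifferentiableAt ℂ (fun t : ℂ => t • z) t)).differentiableWithinAt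

/-- The series `p` may converge only near `0`, but the slice `t ↦ f (t z)` is holomorphic on the
closed disc. Its Cauchy series converges on the whole unit disc, and by uniqueness in one variable
it is `p` restricted to the line. -/
theorem hasFPowerSeriesOnBall_slice {d : ℕ} {f : (Fin d → ℂ) → ℂ} (hf : f ∈ Hol d)
    {p : FormalMultilinearSeries ℂ (Fin d → ℂ) ℂ} (hp : HasFPowerSeriesAt f p 0)
    {z : Fin d → ℂ} (hz : z ∈ unitBall d) :
    HasFPowerSeriesOnBall (fun t : ℂ => f (t • z))
      (p.compContinuousLinearMap (ContinuousLinearMap.toSpanSingleton ℂ z)) 0 1 ∧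
    p.compContinuousLinearMap (ContinuousLinearMap.toSpanSingleton ℂ z) =
      cauchyPowerSeries (fun t : ℂ => f (t • z)) 0 1 := by
  have h1 := DifferentiableOn.hasFPowerSeriesOnBall (R := 1) (c := 0)
    (by simpa using differentiableOn_slice hf hz) one_pos
  have h2 : HasFPowerSeriesAt (fun t : ℂ => f (t • z))
      (p.compContinuousLinearMap (ContinuousLinearMap.toSpanSingleton ℂ z)) 0 := by
    have : HasFPowerSeriesAt f p (ContinuousLinearMap.toSpanSingleton ℂ z 0) := by simpa using hp
    exact this.compContinuousLinearMap
  have h3 := h2.eq_formalMultilinearSeries h1.hasFPowerSeriesAt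
  refine ⟨?_, by simpa using h3⟩
  rw [h3]
  simpa using h1

theorem hasSum_slice {d : ℕ} {f : (Fin d → ℂ) → ℂ} (hf : f ∈ Hol d)
    {p : FormalMultilinearSeries ℂ (Fin d → ℂ) ℂ} (hp : HasFPowerSeriesAt f p 0)
    {z : Fin d → ℂ} (hz : z ∈ unitBall d) : HasSum (fun m => p m fun _ => z) (f z) := by
  obtain ⟨r, hr, hrz⟩ := exists_one_lt_smul_mem_unitBall hz
  -- The slice through `r z` is evaluated at the interior point `1/r`; on the slice through `z` the
  -- relevant point `1` lies on the boundary of the disc.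
  have h := (hasFPowerSeriesOnBall_slice hf hp hrz).1.hasSum (y := (r : ℂ)⁻¹) (by
    rw [Metric.mem_eball, edist_zero_right, ← ofReal_norm, ENNReal.ofReal_lt_one]
    simpa [abs_of_pos (zero_lt_one.trans hr)] using inv_lt_one_of_one_lt₀ hr)
  have hr0 : (r : ℂ) ≠ 0 := by exact_mod_cast (zero_lt_one.trans hr).ne'
  have h0 : (r : ℂ)⁻¹ • (r : ℂ) • z = z := by rw [smul_smul, inv_mul_cancel₀ hr0, one_smul]
  simpa only [FormalMultilinearSeries.compContinuousLinearMap_apply, Function.comp_def, zero_add,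
    ContinuousLinearMap.toSpanSingleton_apply, h0] using h

/-- Cauchy's estimate for `t ↦ f (t z)` on the unit circle, whose points `t z` stay in the polydisc
where `C` is a bound. -/
theorem norm_homogeneous_le {d : ℕ} {f : (Fin d → ℂ) → ℂ} (hf : f ∈ Hol d)
    {p : FormalMultilinearSeries ℂ (Fin d → ℂ) ℂ} (hp : HasFPowerSeriesAt f p 0)
    {z : Fin d → ℂ} (hz : z ∈ unitBall d) {C : ℝ}
    (hC : ∀ w : Fin d → ℂ, (∀ j, ‖w j‖ ≤ ‖z j‖) → ‖f w‖ ≤ C) (m : ℕ) :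
    ‖p m fun _ => z‖ ≤ C := by
  have h1 := (hasFPowerSeriesOnBall_slice hf hp hz).2
  have h2 := norm_cauchyPowerSeries_le (fun t : ℂ => f (t • z)) 0 1 m
  rw [← h1] at h2
  have h3 := ContinuousMultilinearMap.le_opNorm
    (p.compContinuousLinearMap (ContinuousLinearMap.toSpanSingleton ℂ z) m) fun _ => 1
  simp only [FormalMultilinearSeries.compContinuousLinearMap_apply, Function.comp_def,
    ContinuousLinearMap.toSpanSingleton_apply, one_smul, norm_one, Finset.prod_const_one,
    mul_one] at h3
  refine h3.trans (h2.trans ?_)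
  have h4 : ∫ θ : ℝ in 0..2 * Real.pi, ‖f (circleMap 0 1 θ • z)‖ ≤ 2 * Real.pi * C := by
    have := intervalIntegral.norm_integral_le_of_norm_le_const (a := 0) (b := 2 * Real.pi) (C := C)
      (f := fun θ : ℝ => ‖f (circleMap 0 1 θ • z)‖) fun θ _ => by
        rw [norm_norm]
        exact hC _ fun j => by simp
    rw [sub_zero, abs_of_pos Real.two_pi_pos, mul_comm C] at this
    exact (le_abs_self _).trans this
  simp only [abs_one, inv_one, one_pow, mul_one]
  rwa [inv_mul_le_iff₀ Real.two_pi_pos]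

/-! ### From homogeneous polynomials to monomials -/

/-- The multi-index counting the values of `s`. -/
def countIndex {d m : ℕ} (s : Fin m → Fin d) (j : Fin d) : ℕ := (Finset.univ.filter (s · = j)).card

theorem sum_countIndex {d m : ℕ} (s : Fin m → Fin d) : ∑ j, countIndex s j = m := by
  simpa [countIndex] using (Finset.card_eq_sum_card_fiberwise (f := s) (s := Finset.univ)
    (t := Finset.univ) (by simp)).symm

theorem monomialFun_countIndex {d m : ℕ} (s : Fin m → Fin d) (z : Fin d → ℂ) :
    monomialFun (countIndex s) z = ∏ i, z (s i) := by
  rw [monomialFun, ← Finset.prod_fiberwise (s := Finset.univ) (g := s)]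
  refine Finset.prod_congr rfl fun j _ => ?_
  rw [Finset.prod_congr rfl fun i hi => by rw [(Finset.mem_filter.mp hi).2], Finset.prod_const,
    countIndex]

/-- The coefficient of `z^n` in the homogeneous polynomial given by a multilinear form. -/
def multilinearCoeff {d m : ℕ} (p : ContinuousMultilinearMap ℂ (fun _ : Fin m => Fin d → ℂ) ℂ)
    (n : Fin d → ℕ) : ℂ :=
  ∑ s : Fin m → Fin d with countIndex s = n, p fun i => Pi.single (s i) 1

theorem multilinear_apply_eq_sum {d m : ℕ}
    (p : ContinuousMultilinearMap ℂ (fun _ : Fin m => Fin d → ℂ) ℂ) (z : Fin d → ℂ) :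
    (p fun _ => z) =
      ∑ n ∈ Finset.piAntidiag Finset.univ m, multilinearCoeff p n * monomialFun n z := by
  have h1 : (p fun _ => z) =
      ∑ s : Fin m → Fin d, monomialFun (countIndex s) z * p fun i => Pi.single (s i) 1 := by
    have h2 : (fun _ : Fin m => z) = fun _ => ∑ j, z j • (Pi.single j 1 : Fin d → ℂ) := by
      funext i
      simpa using (pi_eq_sum_univ' z)
    rw [h2, p.map_sum]
    refine Finset.sum_congr rfl fun s _ => ?_
    rw [p.map_smul_univ, monomialFun_countIndex, smul_eq_mul]
  rw [h1, ← Finset.sum_fiberwise_of_maps_to (g := countIndex)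
    (t := Finset.piAntidiag Finset.univ m) (by simp [sum_countIndex])]
  refine Finset.sum_congr rfl fun n _ => ?_
  rw [multilinearCoeff, Finset.sum_mul]
  refine Finset.sum_congr rfl fun s hs => ?_
  rw [(Finset.mem_filter.mp hs).2, mul_comm]

/-- The torus mean of `|p|²` is the sum of the squared moduli of all monomial terms and is at most
`C²`, so each term is bounded by `C`. -/
theorem norm_multilinearCoeff_mul_le {d m : ℕ}
    (p : ContinuousMultilinearMap ℂ (fun _ : Fin m => Fin d → ℂ) ℂ) {z : Fin d → ℂ} {C : ℝ}
    (hC : ∀ θ, ‖p fun _ => rotate θ z‖ ≤ C) {n : Fin d → ℕ}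
    (hn : n ∈ Finset.piAntidiag Finset.univ m) :
    ‖multilinearCoeff p n * monomialFun n z‖ ≤ C := by
  classical
  have hC0 : 0 ≤ C := (norm_nonneg _).trans (hC 0)
  -- Extending the coefficients by zero outside degree `m` turns the polynomial into a series over
  -- all multi-indices.
  let a : (Fin d → ℕ) → ℂ := fun n =>
    if n ∈ Finset.piAntidiag Finset.univ m then multilinearCoeff p n else 0
  have ha : ∀ w, HasSum (fun n => a n * monomialFun n w) (p fun _ => w) := fun w => by
    rw [multilinear_apply_eq_sum]
    have := hasSum_sum_of_ne_finset_zero (f := fun n => a n * monomialFun n w)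
      (s := Finset.piAntidiag Finset.univ m) (L := .unconditional _)
      fun n hn => by simp only [a, hn, if_false, zero_mul]
    convert this using 1
    exact Finset.sum_congr rfl fun n hn => by simp only [a, hn, if_true]
  have h1 := lintegral_rotate_sq (f := fun w => p fun _ => w) (ha z).summable fun θ => ha _
  have h2 : ‖a n * monomialFun n z‖ₑ ^ 2 ≤ ENNReal.ofReal C ^ 2 := by
    refine (ENNReal.le_tsum n).trans (h1.symm.le.trans ?_)
    refine (lintegral_mono (g := fun _ => ENNReal.ofReal C ^ 2) fun θ => ?_).trans (by simp)
    simp only [← ofReal_norm]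
    gcongr
    exact hC θ
  have h3 := (ENNReal.pow_le_pow_left_iff two_ne_zero).mp h2
  rw [← ofReal_norm, ENNReal.ofReal_le_ofReal_iff hC0] at h3
  simpa only [a, hn, if_true] using h3

theorem summable_pow_sum {r : ℝ} (h0 : 0 ≤ r) (h1 : r < 1) (d : ℕ) :
    Summable fun n : Fin d → ℕ => r ^ (∑ j, n j) := by
  induction d with
  | zero => exact (hasSum_fintype _).summable
  | succ d ih =>
    rw [← (Fin.consEquiv fun _ : Fin (d + 1) => ℕ).summable_iff]
    refine ((summable_geometric_of_lt_one h0 h1).mul_of_nonneg ih (fun _ => by positivity)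
      fun _ => by positivity).congr fun x => ?_
    simp [Fin.consEquiv, Fin.sum_univ_succ, pow_add]

theorem tsum_degree_fiber {d : ℕ} {E : Type*} [AddCommMonoid E] [TopologicalSpace E]
    (g : (Fin d → ℕ) → E) (m : ℕ) :
    ∑' n : (fun n : Fin d → ℕ => ∑ j, n j) ⁻¹' {m}, g n =
      ∑ n ∈ Finset.piAntidiag Finset.univ m, g n := by
  have h : (fun n : Fin d → ℕ => ∑ j, n j) ⁻¹' {m} =
      ↑(Finset.piAntidiag (Finset.univ : Finset (Fin d)) m) := by
    ext n; simp
  rw [h, Finset.tsum_subtype']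

/-! ### Taylor expansion on the ball -/

/-- `f` is the sum of the power series with coefficients `a` on the ball. -/
def HasExpansion {d : ℕ} (a : (Fin d → ℕ) → ℂ) (f : (Fin d → ℂ) → ℂ) : Prop :=
  ∀ z ∈ unitBall d, HasSum (fun n => a n * monomialFun n z) (f z)

/-- The homogeneous expansion may be split into monomials once absolute convergence is known. The
estimates at `r z` with `r > 1` give it: the term at `n` is at most `C r^(-|n|)`. -/
theorem exists_hasExpansion {d : ℕ} {f : (Fin d → ℂ) → ℂ} (hf : f ∈ Hol d) :
    ∃ a, HasExpansion a f := by
  obtain ⟨p, hp⟩ := hf.1 0 (zero_mem_unitBall d)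
  refine ⟨fun n => multilinearCoeff (p (∑ j, n j)) n, fun z hz => ?_⟩
  obtain ⟨r, hr, hrz⟩ := exists_one_lt_smul_mem_unitBall hz
  have hr0 : 0 < r := zero_lt_one.trans hr
  obtain ⟨C, hC⟩ := exists_bound_on_polydisc hf hrz
  have hs : Summable fun n => multilinearCoeff (p (∑ j, n j)) n * monomialFun n z := by
    refine .of_norm_bounded
      ((summable_pow_sum (inv_nonneg.mpr hr0.le) (inv_lt_one_of_one_lt₀ hr) d).mul_left C)
      fun n => ?_
    have h := norm_multilinearCoeff_mul_le (p (∑ j, n j)) (z := (r : ℂ) • z) (C := C) (fun θ =>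
      norm_homogeneous_le hf hp (rotate_mem_unitBall hrz θ)
        (fun w hw => hC w fun j => (hw j).trans (norm_rotate_apply θ _ j).le) _) (n := n) (by simp)
    rw [monomialFun_smul, mul_left_comm, norm_mul, norm_pow, Complex.norm_real, Real.norm_eq_abs,
      abs_of_pos hr0] at h
    rwa [inv_pow, ← div_eq_mul_inv, le_div_iff₀' (by positivity)]
  have h1 := hs.hasSum.tsum_fiberwise fun n => ∑ j, n j
  simp only [tsum_degree_fiber fun n =>
    multilinearCoeff (p (∑ j, n j)) n * monomialFun n z] at h1
  have h2 : ∀ m, (∑ n ∈ Finset.piAntidiag Finset.univ m,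
      multilinearCoeff (p (∑ j, n j)) n * monomialFun n z) = p m fun _ => z := fun m => by
    rw [multilinear_apply_eq_sum]
    refine Finset.sum_congr rfl fun n hn => ?_
    obtain ⟨rfl, -⟩ := Finset.mem_piAntidiag.mp hn
    rfl
  simp only [h2] at h1
  rw [(hasSum_slice hf hp hz).unique h1]
  exact hs.hasSum

theorem exists_pos_mem_unitBall {d : ℕ} {z : Fin d → ℂ} (hz : z ∈ unitBall d) :
    ∃ r : Fin d → ℝ, (∀ j, ‖z j‖ < r j) ∧ (fun j => (r j : ℂ)) ∈ unitBall d := by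
  have hc : Continuous fun t : ℝ => fun j => ((‖z j‖ + t : ℝ) : ℂ) := by fun_prop
  have h0 : (fun j => ((‖z j‖ + (0 : ℝ) : ℝ) : ℂ)) ∈ unitBall d :=
    mem_unitBall_of_norm_le hz fun j => by simp
  have h1 := hc.continuousAt.preimage_mem_nhds ((isOpen_unitBall d).mem_nhds h0)
  obtain ⟨t, ht, ht0⟩ := (Filter.nonempty_of_mem (Filter.inter_mem
    (mem_nhdsWithin_of_mem_nhds h1) (self_mem_nhdsWithin (s := Set.Ioi (0 : ℝ)))) :
      Set.Nonempty _)
  exact ⟨fun j => ‖z j‖ + t, fun j => by simpa using ht0, ht⟩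

/-- The torus mean is taken at a point with positive coordinates, where no monomial vanishes. -/
theorem HasExpansion.zero_unique {d : ℕ} {a : (Fin d → ℕ) → ℂ} (h : HasExpansion a fun _ => 0) :
    a = 0 := by
  obtain ⟨r, hr, hrb⟩ := exists_pos_mem_unitBall (zero_mem_unitBall d)
  have h1 := lintegral_rotate_sq (f := fun _ => 0) (h _ hrb).summable
    fun θ => h _ (rotate_mem_unitBall hrb θ)
  funext n
  have h2 := (ENNReal.tsum_eq_zero.mp (h1.symm.trans (by simp))) n
  have h3 : monomialFun n (fun j => (r j : ℂ)) ≠ 0 := Finset.prod_ne_zero_iff.mpr fun j _ =>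
    pow_ne_zero _ (Complex.ofReal_ne_zero.mpr ((norm_nonneg _).trans_lt (hr j)).ne')
  simpa [h3] using h2

theorem HasExpansion.unique {d : ℕ} {a b : (Fin d → ℕ) → ℂ} {f : (Fin d → ℂ) → ℂ}
    (ha : HasExpansion a f) (hb : HasExpansion b f) : a = b :=
  sub_eq_zero.mp <| HasExpansion.zero_unique fun z hz => by
    simpa [sub_mul] using (ha z hz).sub (hb z hz)

theorem HasExpansion.add {d : ℕ} {a b : (Fin d → ℕ) → ℂ} {f g : (Fin d → ℂ) → ℂ}
    (ha : HasExpansion a f) (hb : HasExpansion b g) : HasExpansion (a + b) (f + g) := fun z hz => by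
  simpa [add_mul] using (ha z hz).add (hb z hz)

theorem HasExpansion.smul {d : ℕ} {a : (Fin d → ℕ) → ℂ} {f : (Fin d → ℂ) → ℂ}
    (ha : HasExpansion a f) (c : ℂ) : HasExpansion (c • a) (c • f) := fun z hz => by
  simpa [mul_assoc] using (ha z hz).mul_left c

/-- `N f (z)` is the derivative of `t ↦ f (t z)` at `t = 1`, so termwise differentiation in one
variable, on the disc of radius `r > 1`, is enough. -/
theorem HasExpansion.numberFun {d : ℕ} {a : (Fin d → ℕ) → ℂ} {f : (Fin d → ℂ) → ℂ}
    (hf : f ∈ Hol d) (ha : HasExpansion a f) :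
    HasExpansion (fun n => ((∑ j, n j : ℕ) : ℂ) * a n) (numberFun f) := by
  intro z hz
  obtain ⟨r, hr, hrz⟩ := exists_one_lt_smul_mem_unitBall hz
  have hr0 : 0 < r := zero_lt_one.trans hr
  have hmem : ∀ t ∈ Metric.ball (0 : ℂ) r, t • z ∈ unitBall d := fun t ht =>
    mem_unitBall_of_norm_le hrz fun j => by
      have : ‖t‖ < r := by simpa using ht
      simpa [abs_of_pos hr0] using mul_le_mul_of_nonneg_right this.le (norm_nonneg (z j))
  have h1 := Complex.hasSum_deriv_of_summable_norm (U := Metric.ball (0 : ℂ) r) (z := 1)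
    (F := fun n t => a n * monomialFun n (t • z)) (ha _ hrz).summable.norm
    (fun n => by simp only [monomialFun_smul]; fun_prop) Metric.isOpen_ball (fun n t ht => by
      have : ‖t‖ < r := by simpa using ht
      simp only [monomialFun_smul, norm_mul, norm_pow, Complex.norm_real, Real.norm_eq_abs,
        abs_of_pos hr0]
      gcongr) (by simpa using hr)
  have h2 : (fun t : ℂ => ∑' n, a n * monomialFun n (t • z)) =ᶠ[nhds 1] fun t => f (t • z) := by
    filter_upwards [Metric.isOpen_ball.mem_nhds (by simpa using hr : (1 : ℂ) ∈ Metric.ball 0 r)]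
      with t ht
    exact (ha _ (hmem t ht)).tsum_eq
  have h3 : HasDerivAt (fun t : ℂ => f (t • z)) (fderiv ℂ f z z) 1 := by
    have h4 : HasDerivAt (fun t : ℂ => t • z) z 1 := by
      simpa using (hasDerivAt_id (1 : ℂ)).smul_const z
    have h5 : HasFDerivAt f (fderiv ℂ f z) ((1 : ℂ) • z) := by
      rw [one_smul]; exact (hf.1 z hz).differentiableAt.hasFDerivAt
    exact h5.comp_hasDerivAt 1 h4
  rw [h2.deriv_eq, h3.deriv] at h1
  have h6 : GenBergman.numberFun f z = fderiv ℂ f z z := by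
    have h7 := congrArg (fderiv ℂ f z) (pi_eq_sum_univ' z)
    rw [map_sum] at h7
    simpa only [GenBergman.numberFun, if_pos hz, map_smul, smul_eq_mul] using h7.symm
  rw [h6]
  refine h1.congr_fun fun n => ?_
  simp only [monomialFun_smul]
  have h7 : HasDerivAt (fun t : ℂ => a n * (t ^ (∑ j, n j) * monomialFun n z))
      (a n * ((((∑ j, n j : ℕ) : ℂ) * 1 ^ (∑ j, n j - 1)) * monomialFun n z)) 1 :=
    ((hasDerivAt_pow _ _).mul_const _).const_mul _
  rw [h7.deriv]
  ring

/-! ### The operators in Taylor coefficients -/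

/-- The Taylor coefficients at the origin. -/
def taylorCoeff (d : ℕ) : Hol d →ₗ[ℂ] (Fin d → ℕ) → ℂ where
  toFun f := (exists_hasExpansion f.2).choose
  map_add' f g := (exists_hasExpansion (f + g).2).choose_spec.unique <|
    (exists_hasExpansion f.2).choose_spec.add (exists_hasExpansion g.2).choose_spec
  map_smul' c f := (exists_hasExpansion (c • f).2).choose_spec.unique <|
    (exists_hasExpansion f.2).choose_spec.smul c

theorem hasExpansion_taylorCoeff {d : ℕ} (f : Hol d) : HasExpansion (taylorCoeff d f) f.1 :=
  (exists_hasExpansion f.2).choose_spec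

theorem taylorCoeff_eq {d : ℕ} {f : Hol d} {a : (Fin d → ℕ) → ℂ} (h : HasExpansion a f.1) :
    taylorCoeff d f = a :=
  (hasExpansion_taylorCoeff f).unique h

theorem taylorCoeff_injective (d : ℕ) : Function.Injective (taylorCoeff d) := by
  intro f g hfg
  ext z
  by_cases hz : z ∈ unitBall d
  · exact (hasExpansion_taylorCoeff f z hz).unique (hfg ▸ hasExpansion_taylorCoeff g z hz)
  · rw [f.2.2 z hz, g.2.2 z hz]

theorem taylorCoeff_numberOp {d : ℕ} (f : Hol d) (n : Fin d → ℕ) :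
    taylorCoeff d (numberOp d f) n = ((∑ j, n j : ℕ) : ℂ) * taylorCoeff d f n :=
  congrFun (taylorCoeff_eq (f := numberOp d f) ((hasExpansion_taylorCoeff f).numberFun f.2)) n

theorem taylorCoeff_numberOp_pow {d : ℕ} (l : ℕ) (f : Hol d) (n : Fin d → ℕ) :
    taylorCoeff d ((numberOp d ^ l) f) n = ((∑ j, n j : ℕ) : ℂ) ^ l * taylorCoeff d f n := by
  induction l with
  | zero => simp
  | succ l ih =>
    rw [pow_succ', Module.End.mul_apply, taylorCoeff_numberOp, ih]
    ring

theorem taylorCoeff_shiftOp {d : ℕ} (a : ℝ) (k : ℕ) (f : Hol d) (n : Fin d → ℕ) :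
    taylorCoeff d (shiftOp d a k f) n =
      ((∏ i ∈ Finset.range k, (1 + (a + i)⁻¹ * (∑ j, n j : ℕ)) : ℝ) : ℂ) * taylorCoeff d f n := by
  induction k generalizing f with
  | zero => simp [shiftOp]
  | succ k ih =>
    have h : shiftOp d a (k + 1) f =
        shiftOp d a k (f + (((a + k)⁻¹ : ℝ) : ℂ) • numberOp d f) := by
      simp [shiftOp, List.range_succ]
    rw [h, ih, map_add, map_smul, Pi.add_apply, Pi.smul_apply, taylorCoeff_numberOp,
      Finset.prod_range_succ]
    push_cast
    simp only [smul_eq_mul]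
    ring

/-! ### Holomorphic functions from convergent power series -/

theorem exists_multilinear_monomial {d : ℕ} (m : ℕ) (n : Fin d → ℕ) :
    ∃ M : ContinuousMultilinearMap ℂ (fun _ : Fin m => Fin d → ℂ) ℂ,
      ‖M‖ ≤ 1 ∧ (∑ j, n j = m → ∀ w, (M fun _ => w) = monomialFun n w) := by
  by_cases h : ∑ j, n j = m
  · subst h
    -- The `|n|` slots are cut into blocks of length `n j`, and a slot of block `j` reads the `j`-th
    -- coordinate.
    refine ⟨(ContinuousMultilinearMap.mkPiAlgebra ℂ (Fin (∑ j, n j)) ℂ).compContinuousLinearMap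
      fun i => ContinuousLinearMap.proj (finSigmaFinEquiv.symm i).1, ?_, fun _ w => ?_⟩
    · refine ContinuousMultilinearMap.opNorm_le_bound zero_le_one fun v => ?_
      simp only [ContinuousMultilinearMap.compContinuousLinearMap_apply, norm_prod, one_mul,
        ContinuousMultilinearMap.mkPiAlgebra_apply, ContinuousLinearMap.proj_apply]
      exact Finset.prod_le_prod (fun _ _ => norm_nonneg _) fun i _ => norm_le_pi_norm _ _
    · simp only [ContinuousMultilinearMap.compContinuousLinearMap_apply,
        ContinuousMultilinearMap.mkPiAlgebra_apply, ContinuousLinearMap.proj_apply]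
      rw [finSigmaFinEquiv.symm.prod_comp fun x : (j : Fin d) × Fin (n j) => w x.1,
        Fintype.prod_sigma]
      simp [monomialFun]
  · exact ⟨0, by simp, fun h' => absurd h' h⟩

/-- The part of degree `m` has norm at most `∑_{|n| = m} |b_n|`. This is summable in `m`, so the
radius of convergence in the sup norm is at least `1`. -/
theorem analyticOnNhd_powerSeries {d : ℕ} {b : (Fin d → ℕ) → ℂ} (hb : Summable fun n => ‖b n‖) :
    AnalyticOnNhd ℂ (fun w => ∑' n, b n * monomialFun n w) (Metric.ball 0 1) := by
  choose M hM1 hM using exists_multilinear_monomial (d := d)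
  let p : FormalMultilinearSeries ℂ (Fin d → ℂ) ℂ := fun m =>
    ∑ n ∈ Finset.piAntidiag Finset.univ m, b n • M m n
  have hc := (hb.hasSum.tsum_fiberwise fun n => ∑ j, n j).summable
  simp only [tsum_degree_fiber fun n => ‖b n‖] at hc
  have hr : 1 ≤ p.radius := by
    have := p.le_radius_of_summable (r := 1) (Summable.of_nonneg_of_le (fun _ => by positivity)
      (fun m => ?_) hc)
    · simpa using this
    · simp only [NNReal.coe_one, one_pow, mul_one, p]
      refine norm_sum_le_of_le _ fun n _ => ?_
      rw [norm_smul]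
      exact mul_le_of_le_one_right (norm_nonneg _) (hM1 m n)
  have hp := (p.hasFPowerSeriesOnBall (zero_lt_one.trans_le hr)).mono zero_lt_one hr
  have hA := hp.analyticOnNhd
  rw [show (1 : ENNReal) = ENNReal.ofReal 1 by simp, Metric.eball_ofReal] at hA
  refine hA.congr (Metric.isOpen_ball) fun w hw => ?_
  have hw1 : ‖w‖ < 1 := by simpa using hw
  have hs : Summable fun n => b n * monomialFun n w := by
    refine .of_norm_bounded hb fun n => ?_
    rw [norm_mul, norm_monomialFun]
    refine mul_le_of_le_one_right (norm_nonneg _) (Finset.prod_le_one (fun _ _ => by positivity)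
      fun j _ => pow_le_one₀ (norm_nonneg _) ((norm_le_pi_norm w j).trans hw1.le))
  have h1 := hs.hasSum.tsum_fiberwise fun n => ∑ j, n j
  simp only [tsum_degree_fiber fun n => b n * monomialFun n w] at h1
  rw [← h1.tsum_eq]
  refine tsum_congr fun m => ?_
  simp only [p, sum_apply, smul_apply]
  refine Finset.sum_congr rfl fun n hn => ?_
  rw [hM m n (Finset.mem_piAntidiag.mp hn).1, smul_eq_mul]

/-- Analyticity at `z` follows by rescaling a polydisc with polyradius `r` around `0`, which
contains `z` and has `r` in the ball, to the unit polydisc; summability at `r` is that of the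
rescaled coefficients. -/
theorem exists_hol_of_summable {d : ℕ} {a : (Fin d → ℕ) → ℂ}
    (ha : ∀ z ∈ unitBall d, Summable fun n => a n * monomialFun n z) :
    ∃ f : Hol d, taylorCoeff d f = a := by
  classical
  let F : (Fin d → ℂ) → ℂ := fun z => if z ∈ unitBall d then ∑' n, a n * monomialFun n z else 0
  have hF : F ∈ Hol d := by
    refine ⟨fun z hz => ?_, fun z hz => by simp [F, hz]⟩
    obtain ⟨r, hr, hrb⟩ := exists_pos_mem_unitBall hz
    have hr0 : ∀ j, 0 < r j := fun j => (norm_nonneg _).trans_lt (hr j)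
    have h1 := analyticOnNhd_powerSeries (ha _ hrb).norm
    let u : (Fin d → ℂ) →L[ℂ] (Fin d → ℂ) :=
      ContinuousLinearMap.pi fun j => ((r j : ℂ)⁻¹) • ContinuousLinearMap.proj j
    have hu : ∀ w j, u w j = (r j : ℂ)⁻¹ * w j := fun w j => by simp [u]
    have huz : u z ∈ Metric.ball (0 : Fin d → ℂ) 1 := by
      rw [mem_ball_zero_iff, pi_norm_lt_iff one_pos]
      intro j
      rw [hu, norm_mul, norm_inv, Complex.norm_real, Real.norm_eq_abs, abs_of_pos (hr0 j),
        inv_mul_lt_iff₀ (hr0 j), mul_one]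
      exact hr j
    refine ((h1 _ huz).compContinuousLinearMap (u := u)).congr ?_
    filter_upwards [(isOpen_unitBall d).mem_nhds hz] with w hw
    simp only [F, if_pos hw, Function.comp_def]
    refine tsum_congr fun n => ?_
    rw [mul_assoc, monomialFun, monomialFun, monomialFun, ← Finset.prod_mul_distrib]
    congr 1
    refine Finset.prod_congr rfl fun j _ => ?_
    have : (r j : ℂ) ≠ 0 := Complex.ofReal_ne_zero.mpr (hr0 j).ne'
    rw [hu, ← mul_pow, mul_inv_cancel_left₀ this]
  exact ⟨⟨F, hF⟩, taylorCoeff_eq fun z hz => by simpa [F, hz] using (ha z hz).hasSum⟩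

/-! ### Dirichlet integrals over the ball -/

theorem lintegral_comp_norm_sq (g : ℝ → ENNReal) (hg : Measurable g) :
    ∫⁻ w : ℂ, g (‖w‖ ^ 2) = ENNReal.ofReal Real.pi * ∫⁻ x in Set.Ioi (0 : ℝ), g x := by
  rw [← Complex.lintegral_comp_polarCoord_symm]
  have h1 : ∀ p : ℝ × ℝ, ENNReal.ofReal p.1 • g (‖Complex.polarCoord.symm p‖ ^ 2) =
      ENNReal.ofReal p.1 * g (p.1 ^ 2) := fun p => by
    rw [Complex.norm_polarCoord_symm, sq_abs, smul_eq_mul]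
  simp only [h1]
  rw [polarCoord_target, Measure.volume_eq_prod, ← Measure.prod_restrict]
  rw [lintegral_prod _ (by fun_prop)]
  simp only [lintegral_const, Measure.restrict_apply MeasurableSet.univ, Set.univ_inter,
    Real.volume_Ioo]
  have h2 : (fun x : ℝ => x ^ 2) '' Set.Ioi 0 = Set.Ioi 0 := by
    ext x
    refine ⟨?_, fun hx => ⟨√x, Real.sqrt_pos.mpr hx, Real.sq_sqrt (le_of_lt hx)⟩⟩
    rintro ⟨y, hy, rfl⟩
    exact pow_pos (Set.mem_Ioi.mp hy) 2
  have h3 := lintegral_image_eq_lintegral_abs_deriv_mul (s := Set.Ioi (0 : ℝ)) measurableSet_Ioi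
    (f := fun x => x ^ 2) (f' := fun x => 2 * x)
    (fun x _ => by simpa using (hasDerivAt_pow 2 x).hasDerivWithinAt)
    (fun x hx y hy h => (pow_left_inj₀ (le_of_lt hx) (le_of_lt hy) two_ne_zero).mp h) g
  rw [h2] at h3
  rw [h3, ← lintegral_const_mul _ (by fun_prop)]
  refine setLIntegral_congr_fun measurableSet_Ioi fun x hx => ?_
  have hx0 : (0 : ℝ) < x := hx
  rw [abs_of_pos (by positivity), mul_right_comm, ← mul_assoc,
    ← ENNReal.ofReal_mul hx0.le, ← ENNReal.ofReal_mul Real.pi_pos.le]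
  congr 2
  ring

theorem lintegral_Ioo_beta (m : ℕ) {s c : ℝ} (hs : 0 < s) (hc : 0 < c) :
    ∫⁻ x in Set.Ioo 0 c, ENNReal.ofReal (x ^ m * (c - x) ^ (s - 1)) =
      ENNReal.ofReal (c ^ (m + s) * ProbabilityTheory.beta (m + 1) s) := by
  have h2 : (fun x : ℝ => c * x) '' Set.Ioo 0 1 = Set.Ioo 0 c := by
    simpa using Set.image_mul_left_Ioo hc 0 1
  have h3 := lintegral_image_eq_lintegral_abs_deriv_mul (s := Set.Ioo (0 : ℝ) 1) measurableSet_Ioo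
    (f := fun x => c * x) (f' := fun x => c)
    (fun x _ => by simpa using ((hasDerivAt_id x).const_mul c).hasDerivWithinAt)
    (fun x hx y hy h => mul_left_cancel₀ hc.ne' h)
    (fun x => ENNReal.ofReal (x ^ m * (c - x) ^ (s - 1)))
  rw [h2] at h3
  have hm : (0 : ℝ) < m + 1 := by positivity
  have hB := ProbabilityTheory.beta_pos hm hs
  have h4 := ProbabilityTheory.lintegral_betaPDF_eq_one hm hs
  rw [ProbabilityTheory.lintegral_betaPDF] at h4
  -- The factor `1` is replaced by the total mass of the beta density, so that the two integrands
  -- can be compared.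
  rw [h3, ← mul_one (ENNReal.ofReal (_ * _)), ← h4, ← lintegral_const_mul _ (by fun_prop)]
  refine setLIntegral_congr_fun measurableSet_Ioo fun x hx => ?_
  rw [← ENNReal.ofReal_mul (by positivity), ← ENNReal.ofReal_mul (by positivity)]
  congr 1
  have h5 : c - c * x = c * (1 - x) := by ring
  rw [h5, Real.mul_rpow hc.le (by linarith [hx.2]), abs_of_pos hc, add_sub_cancel_right,
    Real.rpow_natCast, Real.rpow_add hc, Real.rpow_natCast, Real.rpow_sub_one hc.ne', mul_pow]
  field_simp

theorem lintegral_disc_beta (m : ℕ) {s : ℝ} (hs : 0 < s) (c : ℝ) :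
    ∫⁻ w : ℂ, (if ‖w‖ ^ 2 < c then
        ENNReal.ofReal ((‖w‖ ^ 2) ^ m * (c - ‖w‖ ^ 2) ^ (s - 1)) else 0) =
      if 0 < c then
        ENNReal.ofReal (Real.pi * (c ^ (m + s) * ProbabilityTheory.beta (m + 1) s)) else 0 := by
  rw [lintegral_comp_norm_sq
    (fun x => if x < c then ENNReal.ofReal (x ^ m * (c - x) ^ (s - 1)) else 0)
    (Measurable.ite measurableSet_Iio (by fun_prop) measurable_const)]
  have h1 : (fun x => if x < c then ENNReal.ofReal (x ^ m * (c - x) ^ (s - 1)) else 0) =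
      (Set.Iio c).indicator fun x => ENNReal.ofReal (x ^ m * (c - x) ^ (s - 1)) := by
    ext x; simp [Set.indicator_apply]
  rw [h1, lintegral_indicator measurableSet_Iio, Measure.restrict_restrict measurableSet_Iio,
    Set.inter_comm, Set.Ioi_inter_Iio]
  split_ifs with hc
  · rw [lintegral_Ioo_beta m hs hc, ENNReal.ofReal_mul Real.pi_pos.le]
  · rw [Set.Ioo_eq_empty hc]
    simp

@[fun_prop]
theorem measurable_normSqC (d : ℕ) : Measurable (normSqC (d := d)) := by
  unfold normSqC; fun_prop

/-- Integrating out the first coordinate over the disc of squared radius `1 - |z'|²` gives a beta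
integral and replaces `s` by `s + n 0 + 1`; hence the induction for all `s`. The Gamma factors
telescope. -/
theorem lintegral_dirichlet (d : ℕ) (n : Fin d → ℕ) {s : ℝ} (hs : 0 < s) :
    ∫⁻ z : Fin d → ℂ, (if normSqC z < 1 then
        ENNReal.ofReal ((∏ j, (‖z j‖ ^ 2) ^ n j) * (1 - normSqC z) ^ (s - 1)) else 0) =
      ENNReal.ofReal (Real.pi ^ d * (∏ j, ((n j).factorial : ℝ)) * Real.Gamma s /
        Real.Gamma (s + d + ∑ j, n j)) := by
  induction d generalizing s with
  | zero =>
    have := (Real.Gamma_pos_of_pos hs).ne'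
    rw [volume_pi, Measure.pi_of_empty _ 0, lintegral_dirac]
    simp [normSqC, this]
  | succ d ih =>
    have hs' : 0 < s + n 0 + 1 := by positivity
    have h0 := (volume_preserving_piFinSuccAbove (fun _ : Fin (d + 1) => ℂ) 0).symm
    rw [← h0.lintegral_comp_emb (MeasurableEquiv.measurableEmbedding _), Measure.volume_eq_prod,
      lintegral_prod_symm' _ ?_]
    swap
    · refine Measurable.comp (g := fun z : Fin (d + 1) → ℂ => (if normSqC z < 1 then
        ENNReal.ofReal ((∏ j, (‖z j‖ ^ 2) ^ n j) * (1 - normSqC z) ^ (s - 1)) else 0)) ?_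
        (MeasurableEquiv.measurable _)
      exact Measurable.ite (isOpen_unitBall _).measurableSet (by fun_prop) measurable_const
    have h1 : ∀ (w : ℂ) (z : Fin d → ℂ),
        (MeasurableEquiv.piFinSuccAbove (fun _ : Fin (d + 1) => ℂ) 0).symm (w, z) =
          Fin.cons w z := fun w z => by
      simp [MeasurableEquiv.piFinSuccAbove]
      rfl
    have h2 : ∀ (w : ℂ) (z : Fin d → ℂ),
        normSqC (Fin.cons w z : Fin (d + 1) → ℂ) = ‖w‖ ^ 2 + normSqC z := fun w z => by
      simp [normSqC, Fin.sum_univ_succ]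
    have h3 : ∀ (z : Fin d → ℂ) (w : ℂ),
        (if normSqC (Fin.cons w z : Fin (d + 1) → ℂ) < 1 then
          ENNReal.ofReal ((∏ j, (‖(Fin.cons w z : Fin (d + 1) → ℂ) j‖ ^ 2) ^ n j) *
            (1 - normSqC (Fin.cons w z : Fin (d + 1) → ℂ)) ^ (s - 1)) else 0) =
        ENNReal.ofReal (∏ j, (‖z j‖ ^ 2) ^ n j.succ) *
          (if ‖w‖ ^ 2 < 1 - normSqC z then
            ENNReal.ofReal ((‖w‖ ^ 2) ^ n 0 * ((1 - normSqC z) - ‖w‖ ^ 2) ^ (s - 1))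
          else 0) := fun z w => by
      rw [h2, mul_ite, mul_zero, ← ENNReal.ofReal_mul (by positivity)]
      refine if_congr lt_sub_iff_add_lt.symm ?_ rfl
      congr 1
      simp only [Fin.prod_univ_succ, Fin.cons_zero, Fin.cons_succ]
      rw [sub_add_eq_sub_sub_swap]
      ring
    have hB := ProbabilityTheory.beta_pos (by positivity : (0 : ℝ) < n 0 + 1) hs
    have h4 : ∀ z : Fin d → ℂ, ENNReal.ofReal (∏ j, (‖z j‖ ^ 2) ^ n j.succ) *
        (if 0 < 1 - normSqC z then ENNReal.ofReal (Real.pi * ((1 - normSqC z) ^ (n 0 + s) *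
          ProbabilityTheory.beta (n 0 + 1) s)) else 0) =
        ENNReal.ofReal (Real.pi * ProbabilityTheory.beta (n 0 + 1) s) *
        (if normSqC z < 1 then ENNReal.ofReal ((∏ j, (‖z j‖ ^ 2) ^ n j.succ) *
          (1 - normSqC z) ^ (s + n 0 + 1 - 1)) else 0) := fun z => by
      rw [mul_ite, mul_ite, mul_zero, mul_zero, ← ENNReal.ofReal_mul (by positivity),
        ← ENNReal.ofReal_mul (by positivity)]
      refine if_congr sub_pos ?_ rfl
      congr 1
      rw [add_sub_cancel_right, add_comm (n 0 : ℝ) s]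
      ring
    simp only [h1, h3]
    have h5 : ∀ z : Fin d → ℂ, Measurable fun w : ℂ => (if ‖w‖ ^ 2 < 1 - normSqC z then
        ENNReal.ofReal ((‖w‖ ^ 2) ^ n 0 * ((1 - normSqC z) - ‖w‖ ^ 2) ^ (s - 1)) else 0) :=
      fun z => Measurable.ite (measurableSet_lt (by fun_prop) measurable_const) (by fun_prop)
        measurable_const
    simp only [lintegral_const_mul _ (h5 _), lintegral_disc_beta _ hs, h4]
    rw [lintegral_const_mul _ (Measurable.ite (isOpen_unitBall _).measurableSet (by fun_prop)
      measurable_const), ih (fun j => n j.succ) hs', ← ENNReal.ofReal_mul (by positivity)]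
    congr 1
    rw [ProbabilityTheory.beta, Real.Gamma_nat_eq_factorial, Fin.prod_univ_succ, Fin.sum_univ_succ,
      show (n 0 + 1 + s : ℝ) = s + n 0 + 1 by ring]
    have e : s + n 0 + 1 + d + ((∑ j : Fin d, n j.succ : ℕ) : ℝ) =
        s + ((d + 1 : ℕ) : ℝ) + ((n 0 + ∑ j : Fin d, n j.succ : ℕ) : ℝ) := by
      push_cast; ring
    rw [e]
    have := (Real.Gamma_pos_of_pos hs').ne'
    field_simp
    ring

/-! ### The norm of `L²(μ_σ)` in Taylor coefficients -/

theorem lintegral_bergmanMeasure {d : ℕ} {σ : ℝ} (hσ : (d : ℝ) < σ) {g : (Fin d → ℂ) → ENNReal}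
    (hg : Measurable g) :
    ∫⁻ z, g z ∂(bergmanMeasure d σ) = ENNReal.ofReal (normConst d σ) *
      ∫⁻ z, if normSqC z < 1 then
        ENNReal.ofReal ((1 - normSqC z) ^ (σ - d - 1)) * g z else 0 := by
  have hc : 0 ≤ normConst d σ := by
    have := Real.Gamma_pos_of_pos ((Nat.cast_nonneg d).trans_lt hσ)
    have := Real.Gamma_pos_of_pos (sub_pos.mpr hσ)
    unfold normConst
    positivity
  rw [bergmanMeasure, lintegral_withDensity_eq_lintegral_mul _ (by fun_prop) hg, hyperbolicMeasure,
    lintegral_withDensity_eq_lintegral_mul _ (by fun_prop) (by fun_prop),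
    ← lintegral_const_mul _ (Measurable.ite (isOpen_unitBall _).measurableSet (by fun_prop)
      measurable_const), ← lintegral_indicator (isOpen_unitBall d).measurableSet]
  refine lintegral_congr fun z => ?_
  classical
  rw [Set.indicator_apply, mul_ite, mul_zero]
  refine if_ctx_congr Iff.rfl (fun hz => ?_) fun _ => rfl
  have hz' : 0 < 1 - normSqC z := sub_pos.mpr hz
  simp only [Pi.mul_apply]
  rw [← mul_assoc, ← mul_assoc, ← ENNReal.ofReal_mul (by positivity), ← ENNReal.ofReal_mul hc,
    mul_left_comm, ← Real.rpow_add hz']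
  congr 4
  ring

/-- The squared norm of `z^n` in the space with parameter `σ`. -/
def weight {d : ℕ} (σ : ℝ) (n : Fin d → ℕ) : ℝ :=
  (∏ j, ((n j).factorial : ℝ)) * Real.Gamma σ / Real.Gamma (σ + ∑ j, n j)

theorem weight_pos {d : ℕ} {σ : ℝ} (hσ : 0 < σ) (n : Fin d → ℕ) : 0 < weight σ n := by
  have := Real.Gamma_pos_of_pos hσ
  have := Real.Gamma_pos_of_pos (by positivity : 0 < σ + (∑ j, n j : ℕ))
  unfold weight
  have : 0 < ∏ j, ((n j).factorial : ℝ) := Finset.prod_pos fun j _ => by positivity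
  positivity

theorem measurable_monomialFun {d : ℕ} (n : Fin d → ℕ) : Measurable (monomialFun n) := by
  unfold monomialFun; fun_prop

theorem lintegral_monomialFun_sq {d : ℕ} {σ : ℝ} (hσ : (d : ℝ) < σ) (n : Fin d → ℕ) :
    ∫⁻ z, ‖monomialFun n z‖ₑ ^ 2 ∂(bergmanMeasure d σ) = ENNReal.ofReal (weight σ n) := by
  have hG := Real.Gamma_pos_of_pos ((Nat.cast_nonneg d).trans_lt hσ)
  have hG' := Real.Gamma_pos_of_pos (sub_pos.mpr hσ)
  have h := measurable_monomialFun n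
  rw [lintegral_bergmanMeasure hσ (by fun_prop)]
  have h1 : ∀ z : Fin d → ℂ, (if normSqC z < 1 then
      ENNReal.ofReal ((1 - normSqC z) ^ (σ - d - 1)) * ‖monomialFun n z‖ₑ ^ 2 else 0) =
      if normSqC z < 1 then ENNReal.ofReal ((∏ j, (‖z j‖ ^ 2) ^ n j) *
        (1 - normSqC z) ^ (σ - d - 1)) else 0 := fun z => by
    rw [← ofReal_norm, norm_monomialFun, ← ENNReal.ofReal_pow (by positivity), mul_comm,
      ← ENNReal.ofReal_mul (by positivity), ← Finset.prod_pow]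
    simp only [← pow_mul, mul_comm]
  simp only [h1]
  rw [lintegral_dirichlet d n (sub_pos.mpr hσ), ← ENNReal.ofReal_mul (by
    unfold normConst; positivity)]
  congr 1
  rw [normConst, weight, sub_add_cancel]
  field_simp

theorem measurable_of_mem_hol {d : ℕ} {f : (Fin d → ℂ) → ℂ} (hf : f ∈ Hol d) : Measurable f := by
  classical
  have h : f = (unitBall d).piecewise f fun _ => 0 := by
    ext z
    by_cases hz : z ∈ unitBall d
    · simp [hz]
    · simp [hz, hf.2 z hz]
  rw [h]
  exact ContinuousOn.measurable_piecewise (fun z hz => (hf.1 z hz).continuousAt.continuousWithinAt)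
    continuousOn_const (isOpen_unitBall d).measurableSet

theorem measurePreserving_rotate {d : ℕ} (θ : UnitAddTorus (Fin d)) :
    MeasurePreserving (rotate θ) := by
  refine volume_preserving_pi (f := fun j w => fourier 1 (θ j) * w) fun j => ?_
  have h := (rotation (AddCircle.toCircle (θ j))).measurePreserving
  have h1 : ⇑(rotation (AddCircle.toCircle (θ j))) = fun w : ℂ => fourier 1 (θ j) * w := by
    ext w
    simp [fourier_apply]
  rwa [h1] at h

theorem lintegral_bergmanMeasure_rotate {d : ℕ} {σ : ℝ} (hσ : (d : ℝ) < σ)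
    (θ : UnitAddTorus (Fin d)) {g : (Fin d → ℂ) → ENNReal} (hg : Measurable g) :
    ∫⁻ z, g (rotate θ z) ∂(bergmanMeasure d σ) = ∫⁻ z, g z ∂(bergmanMeasure d σ) := by
  have hr := measurePreserving_rotate θ
  rw [lintegral_bergmanMeasure hσ (g := fun z => g (rotate θ z)) (hg.comp hr.measurable),
    lintegral_bergmanMeasure hσ hg]
  congr 1
  have hm : Measurable fun z : Fin d → ℂ => if normSqC z < 1 then
      ENNReal.ofReal ((1 - normSqC z) ^ (σ - d - 1)) * g z else 0 :=
    Measurable.ite (isOpen_unitBall _).measurableSet (by fun_prop) measurable_const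
  rw [← hr.lintegral_comp hm]
  simp only [normSqC_rotate]

instance (d : ℕ) (σ : ℝ) : SFinite (bergmanMeasure d σ) := by
  unfold bergmanMeasure hyperbolicMeasure
  infer_instance

theorem ae_mem_unitBall (d : ℕ) (σ : ℝ) : ∀ᵐ z ∂(bergmanMeasure d σ), z ∈ unitBall d :=
  ((withDensity_absolutelyContinuous _ _).trans (withDensity_absolutelyContinuous _ _)).ae_le
    (ae_restrict_mem (isOpen_unitBall d).measurableSet)

theorem continuous_rotate (d : ℕ) :
    Continuous fun x : UnitAddTorus (Fin d) × (Fin d → ℂ) => rotate x.1 x.2 := by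
  unfold rotate
  fun_prop

/-- Rotation invariance inserts a torus average; Tonelli moves it inside, where Parseval applies at
each point of the ball. -/
theorem lintegral_hol_sq {d : ℕ} {σ : ℝ} (hσ : (d : ℝ) < σ) (f : Hol d) :
    ∫⁻ z, ‖f.1 z‖ₑ ^ 2 ∂(bergmanMeasure d σ) =
      ∑' n, ‖taylorCoeff d f n‖ₑ ^ 2 * ENNReal.ofReal (weight σ n) := by
  have hf := measurable_of_mem_hol f.2
  have h1 : ∫⁻ z, ‖f.1 z‖ₑ ^ 2 ∂(bergmanMeasure d σ) = ∫⁻ θ, ∫⁻ z, ‖f.1 (rotate θ z)‖ₑ ^ 2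
      ∂(bergmanMeasure d σ) ∂(torusMeasure d) := by
    simp only [lintegral_bergmanMeasure_rotate hσ _ (hf.enorm.pow_const 2)]
    simp
  have h2 : Measurable (Function.uncurry fun (θ : UnitAddTorus (Fin d)) (z : Fin d → ℂ) =>
      ‖f.1 (rotate θ z)‖ₑ ^ 2) :=
    ((hf.comp (continuous_rotate d).measurable).enorm.pow_const 2)
  rw [h1, lintegral_lintegral_swap h2.aemeasurable]
  have h3 : ∀ᵐ z ∂(bergmanMeasure d σ), ∫⁻ θ, ‖f.1 (rotate θ z)‖ₑ ^ 2 ∂(torusMeasure d) =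
      ∑' n, ‖taylorCoeff d f n‖ₑ ^ 2 * ‖monomialFun n z‖ₑ ^ 2 := by
    filter_upwards [ae_mem_unitBall d σ] with z hz
    rw [lintegral_rotate_sq (hasExpansion_taylorCoeff f z hz).summable fun θ =>
      hasExpansion_taylorCoeff f _ (rotate_mem_unitBall hz θ)]
    simp only [enorm_mul, mul_pow]
  rw [lintegral_congr_ae h3, lintegral_tsum fun n =>
    (((measurable_monomialFun n).enorm.pow_const 2).const_mul _).aemeasurable]
  refine tsum_congr fun n => ?_
  rw [lintegral_const_mul _ ((measurable_monomialFun n).enorm.pow_const 2),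
    lintegral_monomialFun_sq hσ]

theorem enorm_sq_mul_ofReal {c : ℂ} {w : ℝ} :
    ‖c‖ₑ ^ 2 * ENNReal.ofReal w = ENNReal.ofReal (‖c‖ ^ 2 * w) := by
  rw [ENNReal.ofReal_mul (by positivity), ENNReal.ofReal_pow (norm_nonneg _), ofReal_norm]

theorem memLp_hol_iff {d : ℕ} {σ : ℝ} (hσ : (d : ℝ) < σ) (f : Hol d) :
    MemLp f.1 2 (bergmanMeasure d σ) ↔
      Summable fun n => ‖taylorCoeff d f n‖ ^ 2 * weight σ n := by
  have hw := weight_pos (d := d) ((Nat.cast_nonneg d).trans_lt hσ)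
  rw [MemLp, and_iff_right (measurable_of_mem_hol f.2).aestronglyMeasurable,
    eLpNorm_lt_top_iff_lintegral_rpow_enorm_lt_top two_ne_zero ENNReal.ofNat_ne_top]
  have h := lintegral_hol_sq hσ f
  simp only [enorm_sq_mul_ofReal] at h
  simp only [ENNReal.toReal_ofNat, ENNReal.rpow_ofNat, h]
  refine ⟨fun h1 => ?_, fun h1 => h1.tsum_ofReal_lt_top⟩
  refine (ENNReal.summable_toReal h1.ne).congr fun n => ?_
  rw [ENNReal.toReal_ofReal (mul_nonneg (by positivity) (hw n).le)]

theorem hasSum_hol_sq {d : ℕ} {σ : ℝ} (hσ : (d : ℝ) < σ) {f : Hol d}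
    (hf : MemLp f.1 2 (bergmanMeasure d σ)) :
    HasSum (fun n => ‖taylorCoeff d f n‖ ^ 2 * weight σ n)
      (∫ z, ‖f.1 z‖ ^ 2 ∂(bergmanMeasure d σ)) := by
  have hw := weight_pos (d := d) ((Nat.cast_nonneg d).trans_lt hσ)
  have hs := (memLp_hol_iff hσ f).mp hf
  have hn : ∀ n, 0 ≤ ‖taylorCoeff d f n‖ ^ 2 * weight σ n := fun n =>
    mul_nonneg (by positivity) (hw n).le
  have h := lintegral_hol_sq hσ f
  simp only [enorm_sq_mul_ofReal] at h
  rw [integral_eq_lintegral_of_nonneg_ae (.of_forall fun _ => by positivity)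
    ((measurable_of_mem_hol f.2).norm.pow_const 2).aestronglyMeasurable]
  simp only [ENNReal.ofReal_pow (norm_nonneg _), ofReal_norm, h]
  rw [← ENNReal.ofReal_tsum_of_nonneg hn hs, ENNReal.toReal_ofReal (tsum_nonneg hn)]
  exact hs.hasSum

theorem conj_mul_eq_polarization (x y : ℂ) : (starRingEnd ℂ) x * y =
    (((‖x + y‖ ^ 2 - ‖x - y‖ ^ 2 : ℝ) : ℂ) +
      ((‖x - Complex.I * y‖ ^ 2 - ‖x + Complex.I * y‖ ^ 2 : ℝ) : ℂ) * Complex.I) / 4 := by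
  have := inner_eq_sum_norm_sq_div_four (𝕜 := ℂ) x y
  rw [RCLike.inner_apply'] at this
  rw [this]
  simp

/-- Polarization of `hasSum_hol_sq`, applied on both sides. -/
theorem hasSum_inner_hol {d : ℕ} {σ : ℝ} (hσ : (d : ℝ) < σ) {f g : Hol d}
    (hf : MemLp f.1 2 (bergmanMeasure d σ)) (hg : MemLp g.1 2 (bergmanMeasure d σ)) :
    HasSum (fun n => (starRingEnd ℂ) (taylorCoeff d f n) * taylorCoeff d g n * (weight σ n : ℂ))
      (∫ z, (starRingEnd ℂ) (f.1 z) * g.1 z ∂(bergmanMeasure d σ)) := by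
  have hI := hg.const_mul Complex.I
  have h1 := hasSum_hol_sq hσ (f := f + g) (hf.add hg)
  have h2 := hasSum_hol_sq hσ (f := f - g) (hf.sub hg)
  have h3 := hasSum_hol_sq hσ (f := f - Complex.I • g) (hf.sub hI)
  have h4 := hasSum_hol_sq hσ (f := f + Complex.I • g) (hf.add hI)
  have h5 := ((Complex.hasSum_ofReal.mpr (h1.sub h2)).add
    ((Complex.hasSum_ofReal.mpr (h3.sub h4)).mul_right Complex.I)).div_const 4
  have i1 := (hf.add hg).integrable_norm_pow two_ne_zero
  have i2 := (hf.sub hg).integrable_norm_pow two_ne_zero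
  have i3 := (hf.sub hI).integrable_norm_pow two_ne_zero
  have i4 := (hf.add hI).integrable_norm_pow two_ne_zero
  simp only [Pi.add_apply, Pi.sub_apply] at i1 i2 i3 i4
  convert! h5 using 1
  · ext n
    rw [conj_mul_eq_polarization]
    simp only [map_add, map_sub, map_smul, Pi.add_apply, Pi.sub_apply, Pi.smul_apply, smul_eq_mul]
    push_cast
    ring
  · simp only [conj_mul_eq_polarization]
    rw [integral_div, integral_add (i1.sub i2).ofReal ((i3.sub i4).ofReal.mul_const _),
      integral_mul_const, integral_complex_ofReal, integral_complex_ofReal, integral_sub i1 i2, integral_sub i3 i4]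
    rfl

/-! ### Weights and the eigenvalues of the shift operators -/

/-- The eigenvalue `∏ (1 + m / (a + i))` of `shiftOp d a k` on polynomials of degree `m`. -/
def shiftFactor (a : ℝ) (k : ℕ) (m : ℝ) : ℝ := ∏ i ∈ Finset.range k, (1 + (a + i)⁻¹ * m)

theorem weight_add_one {d : ℕ} {σ : ℝ} (hσ : 0 < σ) (n : Fin d → ℕ) :
    weight σ n = (1 + σ⁻¹ * (∑ j, n j : ℕ)) * weight (σ + 1) n := by
  have h1 : 0 < σ + (∑ j, n j : ℕ) := by positivity
  have := (Real.Gamma_pos_of_pos h1).ne'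
  rw [weight, weight, Real.Gamma_add_one hσ.ne', add_right_comm, Real.Gamma_add_one h1.ne']
  field_simp

theorem weight_eq_shiftFactor_mul {d : ℕ} {σ : ℝ} (hσ : 0 < σ) (k : ℕ) (n : Fin d → ℕ) :
    weight σ n = shiftFactor σ k (∑ j, n j : ℕ) * weight (σ + k) n := by
  induction k with
  | zero => simp [shiftFactor]
  | succ k ih =>
    rw [ih, shiftFactor, shiftFactor, Finset.prod_range_succ,
      weight_add_one (by positivity : 0 < σ + k), ← mul_assoc, Nat.cast_succ, ← add_assoc]

theorem shiftFactor_pos {a m : ℝ} (ha : 0 < a) (hm : 0 ≤ m) (k : ℕ) : 0 < shiftFactor a k m :=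
  Finset.prod_pos fun _ _ => by positivity

theorem shiftFactor_anti {a b m : ℝ} (ha : 0 < a) (hab : a ≤ b) (hm : 0 ≤ m) (k : ℕ) :
    shiftFactor b k m ≤ shiftFactor a k m :=
  Finset.prod_le_prod (fun _ _ => by have := ha.trans_le hab; positivity) fun _ _ => by gcongr

/-- With `le_shiftFactor`, this shows that the factor has order `m ^ k` for every `a > 0`; the
maximum with `1` covers `m = 0`. -/
theorem shiftFactor_le {a m : ℝ} (ha : 0 < a) (hm : 0 ≤ m) (k : ℕ) :
    shiftFactor a k m ≤ (1 + a⁻¹) ^ k * max 1 m ^ k := by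
  rw [← mul_pow, shiftFactor, ← Finset.card_range k, ← Finset.prod_const, Finset.card_range]
  refine Finset.prod_le_prod (fun _ _ => by positivity) fun i _ => ?_
  rw [add_mul, one_mul]
  gcongr
  · exact le_max_left _ _
  · linarith [Nat.cast_nonneg (α := ℝ) i]
  · exact le_max_right _ _

theorem le_shiftFactor {a m : ℝ} (ha : 0 < a) (hm : 0 ≤ m) (k : ℕ) :
    max 1 m ^ k ≤ (a + k + 1) ^ k * shiftFactor a k m := by
  rw [shiftFactor, ← Finset.card_range k, ← Finset.prod_const, ← Finset.prod_const,
    Finset.card_range, ← Finset.prod_mul_distrib]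
  refine Finset.prod_le_prod (fun _ _ => by positivity) fun i hi => ?_
  have hi' : (i : ℝ) ≤ k := by exact_mod_cast (Finset.mem_range.mp hi).le
  have h0 : 0 < a + i := by positivity
  have h1 : 1 ≤ (a + k + 1) * (a + i)⁻¹ := by
    rw [← div_eq_mul_inv, one_le_div h0]
    linarith
  rw [mul_add, mul_one, ← mul_assoc]
  refine max_le ?_ ?_
  · have : 0 ≤ (a + k + 1) * (a + i)⁻¹ * m := by positivity
    linarith [Nat.cast_nonneg (α := ℝ) k]
  · have := mul_le_mul_of_nonneg_right h1 hm
    linarith [Nat.cast_nonneg (α := ℝ) k]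

theorem taylorCoeff_shiftOp_eq {d : ℕ} (a : ℝ) (k : ℕ) (f : Hol d) (n : Fin d → ℕ) :
    taylorCoeff d (shiftOp d a k f) n =
      (shiftFactor a k (∑ j, n j : ℕ) : ℂ) * taylorCoeff d f n :=
  taylorCoeff_shiftOp a k f n

/-! ### The space and its form as a weighted `ℓ²` -/

section

variable {d : ℕ} {lam : ℝ} {k : ℕ}

/-- The parameter is raised `k` times from `λ`, which produces the eigenvalue of `B`, and then `k`
times from `λ + k`, which produces that of `A`. -/
theorem weight_eq_mul_mul (hlam : 0 < lam) (n : Fin d → ℕ) :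
    weight lam n = shiftFactor lam k (∑ j, n j : ℕ) *
      (shiftFactor (lam + k) k (∑ j, n j : ℕ) * weight (lam + 2 * k) n) := by
  rw [weight_eq_shiftFactor_mul hlam k, weight_eq_shiftFactor_mul (by positivity) k,
    show lam + k + k = lam + 2 * k by ring]

theorem summable_mul_weight_of_le {σ τ : ℝ} {a b : (Fin d → ℕ) → ℂ} (hσ : 0 < σ) (C : ℝ)
    (hb : Summable fun n => ‖b n‖ ^ 2 * weight τ n)
    (h : ∀ n, ‖a n‖ ^ 2 * weight σ n ≤ C * (‖b n‖ ^ 2 * weight τ n)) :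
    Summable fun n => ‖a n‖ ^ 2 * weight σ n :=
  .of_nonneg_of_le (fun n => mul_nonneg (by positivity) (weight_pos hσ n).le) h (hb.mul_left C)

/-- Let `α` and `β` be the eigenvalues of `A` and `B`. As `w_λ = α β w_{λ+2k}`, it suffices to bound
`α²` and `β²` by multiples of `α β`: `α ≤ β` by monotonicity, and `β ≤ C α` because both have order
`max(1, m)^k`. -/
theorem memLp_shiftOp (hlam : 0 < lam) (hk : (d : ℝ) < lam + 2 * k) {f : Hol d}
    (hf : Summable fun n => ‖taylorCoeff d f n‖ ^ 2 * weight lam n) :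
    MemLp (shiftOp d (lam + k) k f).1 2 (bergmanMeasure d (lam + 2 * k)) ∧
      MemLp (shiftOp d lam k f).1 2 (bergmanMeasure d (lam + 2 * k)) := by
  have hσ : 0 < lam + 2 * k := by positivity
  constructor
  · rw [memLp_hol_iff hk]
    refine summable_mul_weight_of_le hσ 1 hf fun n => ?_
    have hm : (0 : ℝ) ≤ (∑ j, n j : ℕ) := by positivity
    have hA := shiftFactor_pos (by positivity : 0 < lam + k) hm k
    have hw := weight_pos hσ n
    rw [taylorCoeff_shiftOp_eq, norm_mul, Complex.norm_real, Real.norm_eq_abs, abs_of_pos hA,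
      weight_eq_mul_mul (k := k) hlam]
    have h1 := shiftFactor_anti hlam (by simp : lam ≤ lam + k) hm k
    have h2 := mul_le_mul_of_nonneg_right h1 (by positivity :
      0 ≤ ‖taylorCoeff d f n‖ ^ 2 * (shiftFactor (lam + k) k (∑ j, n j : ℕ) *
        weight (lam + 2 * k) n))
    linarith
  · rw [memLp_hol_iff hk]
    refine summable_mul_weight_of_le hσ ((1 + lam⁻¹) ^ k * (lam + k + k + 1) ^ k) hf fun n => ?_
    have hm : (0 : ℝ) ≤ (∑ j, n j : ℕ) := by positivity
    have hA := shiftFactor_pos (by positivity : 0 < lam + k) hm k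
    have hB := shiftFactor_pos hlam hm k
    have hw := weight_pos hσ n
    rw [taylorCoeff_shiftOp_eq, norm_mul, Complex.norm_real, Real.norm_eq_abs, abs_of_pos hB,
      weight_eq_mul_mul (k := k) hlam]
    have h0 := shiftFactor_le hlam hm k
    have h1 := le_shiftFactor (by positivity : 0 < lam + k) hm k
    have h2 := mul_le_mul_of_nonneg_left h1 (by positivity : 0 ≤ (1 + lam⁻¹) ^ k)
    have h3 := mul_le_mul_of_nonneg_right (h0.trans h2) (by positivity :
      0 ≤ ‖taylorCoeff d f n‖ ^ 2 * (shiftFactor lam k (∑ j, n j : ℕ) *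
        weight (lam + 2 * k) n))
    linarith

/-- The ratio `w_λ / w_{λ+2k}` is comparable to `max(1, |n|)^(2k)`. It is controlled by `l = 0` and
`l = k` alone, and it dominates `|n|^(2l)` for all `l ≤ k`. -/
theorem mem_sobolevSubmodule_iff (hlam : 0 < lam) (hk : (d : ℝ) < lam + 2 * k) (f : Hol d) :
    f ∈ sobolevSubmodule d lam k ↔
      Summable fun n => ‖taylorCoeff d f n‖ ^ 2 * weight lam n := by
  have hσ : 0 < lam + 2 * k := by positivity
  constructor
  · intro hf
    have h0 := (memLp_hol_iff hk _).mp (hf 0 (Nat.zero_le k))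
    have h1 := (memLp_hol_iff hk _).mp (hf k le_rfl)
    simp only [taylorCoeff_numberOp_pow, pow_zero, Module.End.one_apply, norm_mul, norm_pow,
      Complex.norm_natCast] at h0 h1
    refine .of_nonneg_of_le (fun n => mul_nonneg (by positivity) (weight_pos hlam n).le)
      (fun n => ?_) ((h0.add h1).mul_left ((1 + lam⁻¹) ^ k * (1 + lam⁻¹) ^ k))
    have hm : (0 : ℝ) ≤ (∑ j, n j : ℕ) := by positivity
    have hw := weight_pos hσ n
    have hA0 := shiftFactor_pos (by positivity : 0 < lam + k) hm k
    have hB := shiftFactor_le hlam hm k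
    have hA := (shiftFactor_anti hlam (by simp : lam ≤ lam + k) hm k).trans hB
    rw [weight_eq_mul_mul (k := k) hlam]
    have h2 := mul_le_mul hB hA hA0.le (by positivity)
    have h3 : max 1 ((∑ j, n j : ℕ) : ℝ) ^ k * max 1 ((∑ j, n j : ℕ) : ℝ) ^ k ≤
        1 + (((∑ j, n j : ℕ) : ℝ) ^ k) ^ 2 := by
      rcases max_choice (1 : ℝ) ((∑ j, n j : ℕ) : ℝ) with h | h <;> rw [h]
      · simp only [one_pow, mul_one]
        linarith [sq_nonneg (((∑ j, n j : ℕ) : ℝ) ^ k)]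
      · linarith
    have h4 := mul_le_mul_of_nonneg_left h3 (by positivity :
      0 ≤ (1 + lam⁻¹) ^ k * (1 + lam⁻¹) ^ k)
    have h5 := mul_le_mul_of_nonneg_right (h2.trans ((by ring : _ = _).trans_le h4))
      (by positivity : 0 ≤ ‖taylorCoeff d f n‖ ^ 2 * weight (lam + 2 * k) n)
    linarith
  · intro hf l hl
    rw [memLp_hol_iff hk]
    refine summable_mul_weight_of_le hσ ((lam + k + 1) ^ k * (lam + k + k + 1) ^ k) hf fun n => ?_
    have hm : (0 : ℝ) ≤ (∑ j, n j : ℕ) := by positivity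
    have hw := weight_pos hσ n
    have hB := le_shiftFactor hlam hm k
    have hA := le_shiftFactor (by positivity : 0 < lam + k) hm k
    have hB0 := shiftFactor_pos hlam hm k
    rw [taylorCoeff_numberOp_pow, norm_mul, norm_pow, Complex.norm_natCast,
      weight_eq_mul_mul (k := k) hlam]
    have h1 : ((∑ j, n j : ℕ) : ℝ) ^ l ≤ max 1 ((∑ j, n j : ℕ) : ℝ) ^ k :=
      (pow_le_pow_left₀ hm (le_max_right _ _) l).trans (pow_le_pow_right₀ (le_max_left _ _) hl)
    have h2 := mul_le_mul (h1.trans hB) (h1.trans hA) (by positivity) (by positivity)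
    have h3 := mul_le_mul_of_nonneg_right h2
      (by positivity : 0 ≤ ‖taylorCoeff d f n‖ ^ 2 * weight (lam + 2 * k) n)
    linarith

theorem summable_taylorCoeff (hlam : 0 < lam) (hk : (d : ℝ) < lam + 2 * k)
    (f : BergmanSpace d lam k) : Summable fun n => ‖taylorCoeff d f.toHol n‖ ^ 2 * weight lam n :=
  (mem_sobolevSubmodule_iff hlam hk f.toHol).mp f.property

theorem hasSum_sobolevInner (hlam : 0 < lam) (hk : (d : ℝ) < lam + 2 * k)
    (f g : BergmanSpace d lam k) :
    HasSum (fun n => (starRingEnd ℂ) (taylorCoeff d f.toHol n) * taylorCoeff d g.toHol n *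
      (weight lam n : ℂ)) (sobolevInner f g) := by
  have h := hasSum_inner_hol hk (memLp_shiftOp hlam hk (summable_taylorCoeff hlam hk f)).1
    (memLp_shiftOp hlam hk (summable_taylorCoeff hlam hk g)).2
  refine h.congr_fun fun n => ?_
  rw [taylorCoeff_shiftOp_eq, taylorCoeff_shiftOp_eq, weight_eq_mul_mul (k := k) hlam, map_mul,
    Complex.conj_ofReal]
  push_cast
  ring

end

/-! ### Convergence on the ball of series with weighted `ℓ²` coefficients -/

theorem summable_Gamma_div_factorial {lam x : ℝ} (hlam : 0 < lam) (hx0 : 0 ≤ x) (hx1 : x < 1) :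
    Summable fun m : ℕ => Real.Gamma (lam + m) / m.factorial * x ^ m := by
  have ht : Filter.Tendsto (fun m : ℕ => (lam + m) / (m + 1) * x) Filter.atTop (nhds (1 * x)) := by
    refine Filter.Tendsto.mul_const x ?_
    have h1 : Filter.Tendsto (fun m : ℕ => 1 + (lam - 1) * (1 / ((m : ℝ) + 1))) Filter.atTop
        (nhds (1 + (lam - 1) * 0)) :=
      (tendsto_one_div_add_atTop_nhds_zero_nat.const_mul _).const_add _
    rw [mul_zero, add_zero] at h1
    refine h1.congr fun m => ?_
    field_simp
    ring
  rw [one_mul] at ht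
  -- The ratios tend to `x < 1`; the midpoint of `x` and `1` bounds them eventually.
  refine summable_of_ratio_norm_eventually_le (r := (1 + x) / 2) (by linarith) ?_
  filter_upwards [ht.eventually (gt_mem_nhds (by linarith : x < (1 + x) / 2))] with m hm
  have hG := Real.Gamma_pos_of_pos (by positivity : 0 < lam + m)
  have hG' := Real.Gamma_pos_of_pos (by positivity : 0 < lam + ((m + 1 : ℕ) : ℝ))
  rw [Real.norm_of_nonneg (by positivity), Real.norm_of_nonneg (by positivity)]
  refine le_trans (le_of_eq ?_) (mul_le_mul_of_nonneg_right hm.le (by positivity :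
    0 ≤ Real.Gamma (lam + m) / m.factorial * x ^ m))
  rw [Nat.cast_succ, ← add_assoc, Real.Gamma_add_one (by positivity), Nat.factorial_succ]
  push_cast
  field_simp
  ring

/-- The multinomial theorem for `(∑ |z_j|²)^m`. Summed over `m`, this is the reproducing kernel on
the diagonal. -/
theorem sum_norm_monomialFun_sq_div_weight {d : ℕ} {lam : ℝ} (hlam : 0 < lam) (z : Fin d → ℂ)
    (m : ℕ) : ∑ n ∈ Finset.piAntidiag Finset.univ m, ‖monomialFun n z‖ ^ 2 / weight lam n =
      (Real.Gamma lam)⁻¹ * (Real.Gamma (lam + m) / m.factorial * normSqC z ^ m) := by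
  rw [normSqC, Finset.sum_pow_eq_sum_piAntidiag, Finset.mul_sum, Finset.mul_sum]
  refine Finset.sum_congr rfl fun n hn => ?_
  obtain ⟨rfl, -⟩ := Finset.mem_piAntidiag.mp hn
  have h1 : (((∑ j, n j).factorial : ℕ) : ℝ) =
      (∏ j, ((n j).factorial : ℝ)) * Nat.multinomial Finset.univ n := by
    exact_mod_cast (Nat.multinomial_spec Finset.univ n).symm
  have h2 : ∏ j, ((n j).factorial : ℝ) ≠ 0 :=
    Finset.prod_ne_zero_iff.mpr fun j _ => by positivity
  have h3 : (Nat.multinomial Finset.univ n : ℝ) ≠ 0 := by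
    exact_mod_cast (Nat.multinomial_pos _ _).ne'
  have h4 := (Real.Gamma_pos_of_pos hlam).ne'
  have h5 := (Real.Gamma_pos_of_pos (by positivity : 0 < lam + (∑ j, n j : ℕ))).ne'
  rw [norm_monomialFun, weight, h1, ← Finset.prod_pow]
  simp only [← pow_mul, mul_comm _ 2]
  field_simp

theorem summable_norm_monomialFun_sq_div_weight {d : ℕ} {lam : ℝ} (hlam : 0 < lam)
    {z : Fin d → ℂ} (hz : z ∈ unitBall d) :
    Summable fun n => ‖monomialFun n z‖ ^ 2 / weight lam n := by
  rw [summable_partition (fun n => div_nonneg (by positivity) (weight_pos hlam n).le)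
    (s := fun m => (fun n : Fin d → ℕ => ∑ j, n j) ⁻¹' {m}) fun n =>
      ⟨∑ j, n j, by simp, fun _ h => by simpa using h.symm⟩]
  refine ⟨fun m => ?_, ?_⟩
  · have h : ((fun n : Fin d → ℕ => ∑ j, n j) ⁻¹' {m}).Finite :=
      (Finset.piAntidiag Finset.univ m).finite_toSet.subset fun n hn => by simpa using hn
    have := h.to_subtype
    exact Summable.of_finite
  · simp only [tsum_degree_fiber fun n => ‖monomialFun n z‖ ^ 2 / weight lam n,
      sum_norm_monomialFun_sq_div_weight hlam]
    exact (summable_Gamma_div_factorial hlam (normSqC_nonneg z) hz).mul_left _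

theorem summable_mul_monomialFun {d : ℕ} {lam : ℝ} (hlam : 0 < lam) {a : (Fin d → ℕ) → ℂ}
    (ha : Summable fun n => ‖a n‖ ^ 2 * weight lam n) {z : Fin d → ℂ} (hz : z ∈ unitBall d) :
    Summable fun n => a n * monomialFun n z := by
  refine .of_norm_bounded (ha.add (summable_norm_monomialFun_sq_div_weight hlam hz)) fun n => ?_
  have hw := weight_pos hlam n
  -- This square gives `2 |a_n z^n| ≤ |a_n|² w_n + |z^n|² / w_n`.
  have h1 : 0 ≤ (‖a n‖ * √(weight lam n) - ‖monomialFun n z‖ / √(weight lam n)) ^ 2 := sq_nonneg _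
  have h2 := Real.sq_sqrt hw.le
  have h3 : √(weight lam n) ≠ 0 := (Real.sqrt_pos.mpr hw).ne'
  have h4 : (‖a n‖ * √(weight lam n) - ‖monomialFun n z‖ / √(weight lam n)) ^ 2 =
      ‖a n‖ ^ 2 * weight lam n + ‖monomialFun n z‖ ^ 2 / weight lam n -
        2 * (‖a n‖ * ‖monomialFun n z‖) := by
    rw [sub_sq, mul_pow, div_pow, h2]
    field_simp
    ring
  have h5 : 0 ≤ ‖a n‖ * ‖monomialFun n z‖ := by positivity
  rw [norm_mul]
  linarith

/-! ### The isometry onto `ℓ²`, and multiplication by coordinates -/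

section

variable {d : ℕ} {lam : ℝ} {k : ℕ}

theorem exists_bergmanSpace_taylorCoeff (hlam : 0 < lam) (hk : (d : ℝ) < lam + 2 * k)
    {a : (Fin d → ℕ) → ℂ} (ha : Summable fun n => ‖a n‖ ^ 2 * weight lam n) :
    ∃ f : BergmanSpace d lam k, taylorCoeff d f.toHol = a := by
  obtain ⟨f, hf⟩ := exists_hol_of_summable fun z hz => summable_mul_monomialFun hlam ha hz
  exact ⟨⟨f, (mem_sobolevSubmodule_iff hlam hk f).mpr (by rwa [hf])⟩, hf⟩

theorem BergmanSpace.toHol_injective :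
    Function.Injective (BergmanSpace.toHol : BergmanSpace d lam k → Hol d) :=
  Subtype.val_injective

theorem norm_sqrt_mul_sq (hlam : 0 < lam) (n : Fin d → ℕ) (c : ℂ) :
    ‖((√(weight lam n) : ℝ) : ℂ) * c‖ ^ 2 = ‖c‖ ^ 2 * weight lam n := by
  rw [norm_mul, mul_pow, Complex.norm_real, Real.norm_eq_abs, sq_abs,
    Real.sq_sqrt (weight_pos hlam n).le, mul_comm]

theorem memℓp_two_iff {ι : Type*} {x : ι → ℂ} : Memℓp x 2 ↔ Summable fun n => ‖x n‖ ^ 2 := by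
  rw [memℓp_gen_iff (by simp)]
  simp

theorem memℓp_weighted_taylorCoeff (hlam : 0 < lam) (hk : (d : ℝ) < lam + 2 * k)
    (f : BergmanSpace d lam k) :
    Memℓp (fun n => ((√(weight lam n) : ℝ) : ℂ) * taylorCoeff d f.toHol n) 2 := by
  refine memℓp_two_iff.mpr ?_
  simpa only [norm_sqrt_mul_sq hlam] using summable_taylorCoeff hlam hk f

/-- The weighted Taylor coefficients `√w_n a_n`. -/
def coeffMap (hlam : 0 < lam) (hk : (d : ℝ) < lam + 2 * k) :
    BergmanSpace d lam k →ₗ[ℂ] lp (fun _ : Fin d → ℕ => ℂ) 2 where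
  toFun f := ⟨fun n => ((√(weight lam n) : ℝ) : ℂ) * taylorCoeff d f.toHol n,
    memℓp_weighted_taylorCoeff hlam hk f⟩
  map_add' f g := Subtype.ext <| funext fun n => by
    show ((√(weight lam n) : ℝ) : ℂ) * taylorCoeff d (f.toHol + g.toHol) n = _
    rw [map_add]
    exact mul_add _ _ _
  map_smul' c f := Subtype.ext <| funext fun n => by
    show ((√(weight lam n) : ℝ) : ℂ) * taylorCoeff d (c • f.toHol) n = _
    rw [map_smul]
    exact mul_left_comm _ _ _

/-- Surjectivity is the source of completeness: the coefficients `x_n / √w_n` define a holomorphic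
function for every `x` in `ℓ²`. -/
theorem coeffMap_bijective (hlam : 0 < lam) (hk : (d : ℝ) < lam + 2 * k) :
    Function.Bijective (coeffMap hlam hk) := by
  have hw : ∀ n : Fin d → ℕ, ((√(weight lam n) : ℝ) : ℂ) ≠ 0 := fun n =>
    Complex.ofReal_ne_zero.mpr (Real.sqrt_pos.mpr (weight_pos hlam n)).ne'
  refine ⟨fun f g hfg => ?_, fun x => ?_⟩
  · refine BergmanSpace.toHol_injective (taylorCoeff_injective d (funext fun n => ?_))
    exact mul_left_cancel₀ (hw n) (congrFun (congrArg Subtype.val hfg) n)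
  · obtain ⟨f, hf⟩ := exists_bergmanSpace_taylorCoeff (k := k) hlam hk
      (a := fun n => (((√(weight lam n) : ℝ) : ℂ))⁻¹ * x n) (by
        refine (memℓp_two_iff.mp x.2).congr fun n => ?_
        rw [← norm_sqrt_mul_sq hlam, mul_inv_cancel_left₀ (hw n)])
    refine ⟨f, Subtype.ext (funext fun n => ?_)⟩
    show ((√(weight lam n) : ℝ) : ℂ) * taylorCoeff d f.toHol n = x n
    rw [hf, mul_inv_cancel_left₀ (hw n)]

/-- The weighted Taylor coefficients as a linear bijection onto `ℓ²`. -/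
def coeffEquiv (hlam : 0 < lam) (hk : (d : ℝ) < lam + 2 * k) :
    BergmanSpace d lam k ≃ₗ[ℂ] lp (fun _ : Fin d → ℕ => ℂ) 2 :=
  LinearEquiv.ofBijective (coeffMap hlam hk) (coeffMap_bijective hlam hk)

theorem coeffEquiv_apply (hlam : 0 < lam) (hk : (d : ℝ) < lam + 2 * k) (f : BergmanSpace d lam k)
    (n : Fin d → ℕ) : coeffEquiv hlam hk f n =
      ((√(weight lam n) : ℝ) : ℂ) * taylorCoeff d f.toHol n := rfl

theorem sobolevInner_eq_inner (hlam : 0 < lam) (hk : (d : ℝ) < lam + 2 * k)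
    (f g : BergmanSpace d lam k) :
    sobolevInner f g = inner ℂ (coeffEquiv hlam hk f) (coeffEquiv hlam hk g) := by
  refine (hasSum_sobolevInner hlam hk f g).unique
    ((lp.hasSum_inner (coeffEquiv hlam hk f) (coeffEquiv hlam hk g)).congr_fun fun n => ?_)
  rw [coeffEquiv_apply, coeffEquiv_apply, RCLike.inner_apply', map_mul, Complex.conj_ofReal,
    mul_mul_mul_comm, ← Complex.ofReal_mul, Real.mul_self_sqrt (weight_pos hlam n).le, mul_comm]

/-- The form `sobolevInner` is an inner product. -/
@[reducible]
def sobolevCore (hlam : 0 < lam) (hk : (d : ℝ) < lam + 2 * k) :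
    InnerProductSpace.Core ℂ (BergmanSpace d lam k) where
  inner := sobolevInner
  conj_inner_symm f g := by simp only [sobolevInner_eq_inner hlam hk, inner_conj_symm]
  re_inner_nonneg f := by
    rw [sobolevInner_eq_inner hlam hk]
    exact inner_self_nonneg
  add_left f g h := by simp only [sobolevInner_eq_inner hlam hk, map_add, inner_add_left]
  smul_left f g c := by simp only [sobolevInner_eq_inner hlam hk, map_smul, inner_smul_left]
  definite f hf := by
    rw [sobolevInner_eq_inner hlam hk, inner_self_eq_zero] at hf
    exact (map_eq_zero_iff _ (coeffEquiv hlam hk).injective).mp hf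

theorem weight_add_single (hlam : 0 < lam) (n : Fin d → ℕ) (j : Fin d) :
    weight lam (n + Pi.single j 1) = (n j + 1) / (lam + (∑ i, n i : ℕ)) * weight lam n := by
  have h0 : 0 < lam + (∑ i, n i : ℕ) := by positivity
  have h1 : ∏ i, (((n + Pi.single j 1 : Fin d → ℕ) i).factorial : ℝ) =
      (n j + 1) * ∏ i, ((n i).factorial : ℝ) := by
    rw [← Finset.mul_prod_erase _ _ (Finset.mem_univ j),
      ← Finset.mul_prod_erase Finset.univ (fun i => ((n i).factorial : ℝ)) (Finset.mem_univ j),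
      ← mul_assoc]
    congr 1
    · simp [Nat.factorial_succ]
    · refine Finset.prod_congr rfl fun i hi => ?_
      simp [Finset.ne_of_mem_erase hi]
  have h2 : ∑ i, (n + Pi.single j 1 : Fin d → ℕ) i = (∑ i, n i) + 1 := by
    simp [Finset.sum_add_distrib]
  rw [weight, weight, h1, h2, Nat.cast_succ, ← add_assoc, Real.Gamma_add_one h0.ne']
  field_simp

theorem add_single_injective (j : Fin d) :
    Function.Injective fun n : Fin d → ℕ => n + Pi.single j 1 := add_left_injective _

/-- The coefficients of `z_j f`, if `f` has the coefficients `a`. -/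
def shiftCoeff (j : Fin d) (a : (Fin d → ℕ) → ℂ) (n : Fin d → ℕ) : ℂ :=
  if n j = 0 then 0 else a (n - Pi.single j 1)

theorem shiftCoeff_add_single (j : Fin d) (a : (Fin d → ℕ) → ℂ) (n : Fin d → ℕ) :
    shiftCoeff j a (n + Pi.single j 1) = a n := by
  simp [shiftCoeff]

theorem shiftCoeff_eq_zero (j : Fin d) (a : (Fin d → ℕ) → ℂ) {n : Fin d → ℕ}
    (hn : n ∉ Set.range fun n : Fin d → ℕ => n + Pi.single j 1) : shiftCoeff j a n = 0 := by
  refine if_pos (not_not.mp fun h => hn ⟨n - Pi.single j 1, ?_⟩)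
  refine tsub_add_cancel_of_le fun i => ?_
  by_cases hi : i = j
  · subst hi; simpa using Nat.one_le_iff_ne_zero.mpr h
  · simp [hi]

theorem monomialFun_add (m n : Fin d → ℕ) (z : Fin d → ℂ) :
    monomialFun (m + n) z = monomialFun m z * monomialFun n z := by
  simp [monomialFun, pow_add, Finset.prod_mul_distrib]

theorem monomialFun_single (j : Fin d) (z : Fin d → ℂ) :
    monomialFun (Pi.single j 1) z = z j := by
  rw [monomialFun, Finset.prod_eq_single j (fun i _ hi => by simp [hi]) (by simp)]
  simp

theorem HasExpansion.coord_mul {a : (Fin d → ℕ) → ℂ} {f : (Fin d → ℂ) → ℂ} (h : HasExpansion a f)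
    (j : Fin d) : HasExpansion (shiftCoeff j a) fun z => z j * f z := by
  intro z hz
  rw [← (add_single_injective j).hasSum_iff fun n hn => by simp [shiftCoeff_eq_zero j a hn]]
  refine ((h z hz).mul_left (z j)).congr_fun fun n => ?_
  simp only [Function.comp_apply, shiftCoeff_add_single, monomialFun_add, monomialFun_single]
  ring

theorem coord_mul_mem_hol {f : (Fin d → ℂ) → ℂ} (hf : f ∈ Hol d) (j : Fin d) :
    (fun z => z j * f z) ∈ Hol d :=
  ⟨fun z hz => ((ContinuousLinearMap.proj (R := ℂ) j).analyticAt z).mul (hf.1 z hz),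
    fun z hz => by simp [hf.2 z hz]⟩

theorem hasSum_shiftCoeff_iff (j : Fin d) (a : (Fin d → ℕ) → ℂ) (s : ℝ) :
    HasSum (fun n => ‖shiftCoeff j a n‖ ^ 2 * weight lam n) s ↔
      HasSum (fun n => ‖a n‖ ^ 2 * weight lam (n + Pi.single j 1)) s := by
  rw [← (add_single_injective j).hasSum_iff fun n hn => by simp [shiftCoeff_eq_zero j a hn]]
  simp only [Function.comp_def, shiftCoeff_add_single]

/-- As `n_j ≤ |n|`, the ratio is at most `(|n| + 1) / (λ + |n|)`, which lies between `1` and `1/λ`.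
-/
theorem weight_add_single_le (hlam : 0 < lam) (n : Fin d → ℕ) (j : Fin d) :
    weight lam (n + Pi.single j 1) ≤ max 1 (1 / lam) * weight lam n := by
  rw [weight_add_single hlam]
  refine mul_le_mul_of_nonneg_right ?_ (weight_pos hlam n).le
  have hj : (n j : ℝ) ≤ (∑ i, n i : ℕ) := by
    exact_mod_cast Finset.single_le_sum (f := n) (fun _ _ => Nat.zero_le _) (Finset.mem_univ j)
  have hm : (0 : ℝ) ≤ (∑ i, n i : ℕ) := by positivity
  rw [div_le_iff₀ (by positivity)]
  rcases le_total 1 lam with h | h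
  · have := mul_le_mul_of_nonneg_right (le_max_left 1 (1 / lam))
      (by positivity : 0 ≤ lam + (∑ i, n i : ℕ))
    linarith
  · have h1 := mul_le_mul_of_nonneg_right (le_max_right 1 (1 / lam))
      (by positivity : 0 ≤ lam + (∑ i, n i : ℕ))
    have h2 : 1 / lam * (lam + (∑ i, n i : ℕ)) = 1 + 1 / lam * (∑ i, n i : ℕ) := by
      field_simp
    have h3 := mul_le_mul_of_nonneg_right ((one_le_div hlam).mpr h) hm
    linarith

/-- Multiplication by `z_j`. -/
def coordMul (hlam : 0 < lam) (hk : (d : ℝ) < lam + 2 * k) (j : Fin d) :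
    BergmanSpace d lam k →ₗ[ℂ] BergmanSpace d lam k where
  toFun f := ⟨⟨fun z => z j * f z, coord_mul_mem_hol f.toHol.2 j⟩, by
    rw [mem_sobolevSubmodule_iff hlam hk,
      taylorCoeff_eq (f := ⟨_, coord_mul_mem_hol f.toHol.2 j⟩)
        ((hasExpansion_taylorCoeff f.toHol).coord_mul j)]
    refine ((hasSum_shiftCoeff_iff j _ _).mpr (Summable.hasSum ?_)).summable
    refine .of_nonneg_of_le (fun n => mul_nonneg (by positivity) (weight_pos hlam _).le)
      (fun n => ?_) ((summable_taylorCoeff hlam hk f).mul_left (max 1 (1 / lam)))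
    rw [mul_left_comm]
    exact mul_le_mul_of_nonneg_left (weight_add_single_le hlam n j) (by positivity)⟩
  map_add' f g := BergmanSpace.toHol_injective <| Subtype.ext <| funext fun z =>
    mul_add (z j) (f z) (g z)
  map_smul' c f := BergmanSpace.toHol_injective <| Subtype.ext <| funext fun z =>
    mul_left_comm (z j) c (f z)

theorem coordMul_apply (hlam : 0 < lam) (hk : (d : ℝ) < lam + 2 * k) (j : Fin d)
    (f : BergmanSpace d lam k) (z : Fin d → ℂ) : coordMul hlam hk j f z = z j * f z := rfl

theorem taylorCoeff_coordMul (hlam : 0 < lam) (hk : (d : ℝ) < lam + 2 * k) (j : Fin d)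
    (f : BergmanSpace d lam k) :
    taylorCoeff d (coordMul hlam hk j f).toHol = shiftCoeff j (taylorCoeff d f.toHol) :=
  taylorCoeff_eq ((hasExpansion_taylorCoeff f.toHol).coord_mul j)

theorem hasSum_re_sobolevInner_self (hlam : 0 < lam) (hk : (d : ℝ) < lam + 2 * k)
    (f : BergmanSpace d lam k) :
    HasSum (fun n => ‖taylorCoeff d f.toHol n‖ ^ 2 * weight lam n) (sobolevInner f f).re := by
  refine (Complex.hasSum_re (hasSum_sobolevInner hlam hk f f)).congr_fun fun n => ?_
  rw [Complex.conj_mul', ← Complex.ofReal_pow, ← Complex.ofReal_mul, Complex.ofReal_re]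

theorem hasSum_re_sobolevInner_coordMul (hlam : 0 < lam) (hk : (d : ℝ) < lam + 2 * k) (j : Fin d)
    (f : BergmanSpace d lam k) :
    HasSum (fun n => ‖taylorCoeff d f.toHol n‖ ^ 2 * weight lam (n + Pi.single j 1))
      (sobolevInner (coordMul hlam hk j f) (coordMul hlam hk j f)).re := by
  have h := hasSum_re_sobolevInner_self hlam hk (coordMul hlam hk j f)
  rwa [taylorCoeff_coordMul, hasSum_shiftCoeff_iff] at h

theorem re_sobolevInner_coordMul_le (hlam : 0 < lam) (hk : (d : ℝ) < lam + 2 * k) (j : Fin d)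
    (f : BergmanSpace d lam k) :
    (sobolevInner (coordMul hlam hk j f) (coordMul hlam hk j f)).re ≤
      max 1 (1 / lam) * (sobolevInner f f).re := by
  refine hasSum_le (fun n => ?_) (hasSum_re_sobolevInner_coordMul hlam hk j f)
    ((hasSum_re_sobolevInner_self hlam hk f).mul_left _)
  rw [mul_left_comm]
  exact mul_le_mul_of_nonneg_left (weight_add_single_le hlam n j) (by positivity)

/-- The witness is `z_j^m`, for which `n_j = |n| = m`. -/
theorem exists_re_sobolevInner_coordMul_eq (hlam : 0 < lam) (hk : (d : ℝ) < lam + 2 * k)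
    (j : Fin d) (m : ℕ) : ∃ f : BergmanSpace d lam k, 0 < (sobolevInner f f).re ∧
      (sobolevInner (coordMul hlam hk j f) (coordMul hlam hk j f)).re =
        (m + 1) / (lam + m) * (sobolevInner f f).re := by
  classical
  have hz : ∀ n ≠ Pi.single j m, ∀ w : ℝ,
      ‖(Pi.single (Pi.single j m) 1 : (Fin d → ℕ) → ℂ) n‖ ^ 2 * w = 0 := fun n hn w => by
    simp [hn]
  obtain ⟨f, hf⟩ := exists_bergmanSpace_taylorCoeff (k := k) hlam hk
    (a := Pi.single (Pi.single j m) 1) (hasSum_single (Pi.single j m)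
      fun n hn => hz n hn (weight lam n)).summable
  have h1 := hasSum_re_sobolevInner_self hlam hk f
  have h2 := hasSum_re_sobolevInner_coordMul hlam hk j f
  rw [hf] at h1 h2
  have h3 := h1.unique (hasSum_single (Pi.single j m) fun n hn => hz n hn (weight lam n))
  have h4 := h2.unique (hasSum_single (Pi.single j m) fun n hn =>
    hz n hn (weight lam (n + Pi.single j 1)))
  rw [weight_add_single hlam] at h4
  simp only [Pi.single_eq_same, norm_one, one_pow, one_mul, Finset.sum_pi_single',
    Finset.mem_univ, if_true] at h3 h4
  refine ⟨f, h3 ▸ weight_pos hlam _, ?_⟩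
  rw [h3, h4]

end

/-! ### Bounded operators on an abstract Hilbert space of functions -/

theorem completeSpace_of_linearEquiv {V W : Type*} [NormedAddCommGroup V] [InnerProductSpace ℂ V]
    [NormedAddCommGroup W] [InnerProductSpace ℂ W] [CompleteSpace W] (e : V ≃ₗ[ℂ] W)
    (he : ∀ f g, inner ℂ f g = inner ℂ (e f) (e g)) : CompleteSpace V :=
  ((e.isometryOfInner fun f g => (he f g).symm).isometry.isUniformInducing.completeSpace_congr
    e.surjective).mpr inferInstance

section

variable {V : Type*} [NormedAddCommGroup V] [InnerProductSpace ℂ V] {d : ℕ} {lam : ℝ}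

/-- The lower bound comes from `m → ∞` if `λ ≥ 1` and from `m = 0` if `λ < 1`. -/
theorem norm_coord_operator (hlam : 0 < lam) (T : V →L[ℂ] V)
    (hbound : ∀ f, ‖T f‖ ^ 2 ≤ max 1 (1 / lam) * ‖f‖ ^ 2)
    (hex : ∀ m : ℕ, ∃ f, 0 < ‖f‖ ^ 2 ∧ ‖T f‖ ^ 2 = (m + 1) / (lam + m) * ‖f‖ ^ 2) :
    (1 ≤ lam → ‖T‖ = 1) ∧ (lam < 1 → ‖T‖ = 1 / √lam) := by
  have hle : ‖T‖ ≤ √(max 1 (1 / lam)) := T.opNorm_le_bound (Real.sqrt_nonneg _) fun f => by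
    refine le_of_sq_le_sq ?_ (by positivity)
    rw [mul_pow, Real.sq_sqrt (by positivity)]
    exact hbound f
  have hge : ∀ m : ℕ, ((m : ℝ) + 1) / (lam + m) ≤ ‖T‖ ^ 2 := fun m => by
    obtain ⟨f, hf, h⟩ := hex m
    refine le_of_mul_le_mul_right ?_ hf
    rw [← h, ← mul_pow]
    exact pow_le_pow_left₀ (norm_nonneg _) (T.le_opNorm f) 2
  constructor
  · intro h1
    rw [max_eq_left ((div_le_one hlam).mpr h1), Real.sqrt_one] at hle
    have ht : Filter.Tendsto (fun m : ℕ => ((m : ℝ) + 1) / (lam + m)) Filter.atTop (nhds 1) := by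
      -- This is the reciprocal `(λ + m) / (m + 1)`.
      have h2 : Filter.Tendsto (fun m : ℕ => 1 + (lam - 1) * (1 / ((m : ℝ) + 1))) Filter.atTop
          (nhds (1 + (lam - 1) * 0)) :=
        (tendsto_one_div_add_atTop_nhds_zero_nat.const_mul _).const_add _
      rw [mul_zero, add_zero] at h2
      have h3 := h2.inv₀ one_ne_zero
      rw [inv_one] at h3
      refine h3.congr fun m => ?_
      have h4 : (m : ℝ) + 1 ≠ 0 := by positivity
      rw [eq_div_iff (by positivity), inv_mul_eq_iff_eq_mul₀]
      · field_simp
        ring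
      · have : 0 ≤ (lam - 1) * (1 / ((m : ℝ) + 1)) := mul_nonneg (by linarith) (by positivity)
        positivity
    refine le_antisymm hle ?_
    have h5 := le_of_tendsto' ht hge
    exact (one_le_sq_iff₀ (norm_nonneg _)).mp h5
  · intro h1
    rw [max_eq_right ((one_le_div hlam).mpr h1.le)] at hle
    have h2 := hge 0
    rw [Nat.cast_zero, zero_add, add_zero] at h2
    rw [← Real.sqrt_one, ← Real.sqrt_div zero_le_one]
    exact le_antisymm hle ((Real.sqrt_le_left (norm_nonneg _)).mpr h2)

theorem exists_monomial_operator (ev : V → (Fin d → ℂ) → ℂ) (T : Fin d → V →L[ℂ] V)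
    (hT : ∀ j f z, ev (T j f) z = z j * ev f z) (n : Fin d → ℕ) :
    ∃ M : V →L[ℂ] V, ∀ f z, ev (M f) z = monomialFun n z * ev f z := by
  let S : AddSubmonoid (Fin d → ℕ) :=
    { carrier := {n | ∃ M : V →L[ℂ] V, ∀ f z, ev (M f) z = monomialFun n z * ev f z}
      zero_mem' := ⟨.id ℂ V, fun f z => by simp [monomialFun]⟩
      add_mem' := by
        rintro m n ⟨M, hM⟩ ⟨N, hN⟩
        exact ⟨M.comp N, fun f z => by
          rw [ContinuousLinearMap.comp_apply, hM, hN, monomialFun_add, mul_assoc]⟩ }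
  have h : ∑ j, n j • (Pi.single j 1 : Fin d → ℕ) ∈ S := S.sum_mem fun j _ =>
    S.nsmul_mem ⟨T j, fun f z => by rw [hT, monomialFun_single]⟩ _
  rwa [← pi_eq_sum_univ' n] at h

theorem exists_bounded_operators [CompleteSpace V] (hlam : 0 < lam) (ev : V → (Fin d → ℂ) → ℂ)
    (hev : Function.Injective ev) (T : Fin d → V →ₗ[ℂ] V)
    (hT : ∀ j f z, ev (T j f) z = z j * ev f z)
    (hbound : ∀ j f, ‖T j f‖ ^ 2 ≤ max 1 (1 / lam) * ‖f‖ ^ 2)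
    (hex : ∀ j, ∀ m : ℕ, ∃ f, 0 < ‖f‖ ^ 2 ∧ ‖T j f‖ ^ 2 = (m + 1) / (lam + m) * ‖f‖ ^ 2) :
    ∃ M : (Fin d → ℕ) → (V →L[ℂ] V),
      (∀ n f z, ev (M n f) z = monomialFun n z * ev f z) ∧
      (∀ j, (1 ≤ lam → ‖M (Pi.single j 1)‖ = 1) ∧ (lam < 1 → ‖M (Pi.single j 1)‖ = 1 / √lam)) ∧
      ∀ φ : MvPolynomial (Fin d ⊕ Fin d) ℂ, ∃ S : V →L[ℂ] V, ∀ f, S f = toeplitz M φ f := by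
  have hc : ∀ j f, ‖T j f‖ ≤ √(max 1 (1 / lam)) * ‖f‖ := fun j f => by
    refine le_of_sq_le_sq ?_ (by positivity)
    rw [mul_pow, Real.sq_sqrt (by positivity)]
    exact hbound j f
  choose M hM using exists_monomial_operator ev (fun j => (T j).mkContinuous _ (hc j)) hT
  -- `M` was merely chosen; injectivity of `ev` identifies it with `T j`, so the norm estimates
  -- carry over.
  have hMT : ∀ j f, M (Pi.single j 1) f = T j f := fun j f => hev <| funext fun z => by
    rw [hM, hT, monomialFun_single]
  refine ⟨M, hM, fun j => norm_coord_operator hlam _ (fun f => ?_) fun m => ?_, fun φ =>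
    ⟨∑ s ∈ φ.support, φ.coeff s • (ContinuousLinearMap.adjoint (M fun j => s (Sum.inl j))).comp
      (M fun j => s (Sum.inr j)), fun f => ?_⟩⟩
  · rw [hMT]
    exact hbound j f
  · simp only [hMT]
    exact hex j m
  · simp [toeplitz]

end

end GenBergman

end

theorem mainTheorem8 (d : ℕ) (lam : ℝ) (hlam : 0 < lam) (k : ℕ) (hk : (d : ℝ) < lam + 2 * k) :
    -- the form `⟨f, g⟩_λ` is an inner product, for which the space is complete
    ∃ c : InnerProductSpace.Core ℂ (GenBergman.BergmanSpace d lam k),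
      (∀ f g, c.inner f g = GenBergman.sobolevInner f g) ∧
      letI : NormedAddCommGroup (GenBergman.BergmanSpace d lam k) := c.toNormedAddCommGroup
      letI : InnerProductSpace ℂ (GenBergman.BergmanSpace d lam k) := .ofCore c.toCore
      ∃ _ : CompleteSpace (GenBergman.BergmanSpace d lam k),
      -- multiplication by each monomial is a bounded operator
      ∃ M : (Fin d → ℕ) →
          (GenBergman.BergmanSpace d lam k →L[ℂ] GenBergman.BergmanSpace d lam k),
        (∀ n f z, (M n f) z = GenBergman.monomialFun n z * f z) ∧
        -- the norms of the operators `M_{z_j}`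
        (∀ j : Fin d,
          (1 ≤ lam → ‖M (Pi.single j 1)‖ = 1) ∧
          (lam < 1 → ‖M (Pi.single j 1)‖ = 1 / √lam)) ∧
        -- Toeplitz operators with polynomial symbols are bounded
        (∀ φ : MvPolynomial (Fin d ⊕ Fin d) ℂ,
          ∃ T : GenBergman.BergmanSpace d lam k →L[ℂ] GenBergman.BergmanSpace d lam k,
            ∀ f, T f = GenBergman.toeplitz M φ f) := by
  refine ⟨GenBergman.sobolevCore hlam hk, fun _ _ => rfl, ?_⟩
  let i1 : NormedAddCommGroup (GenBergman.BergmanSpace d lam k) :=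
    (GenBergman.sobolevCore hlam hk).toNormedAddCommGroup
  let i2 : InnerProductSpace ℂ (GenBergman.BergmanSpace d lam k) :=
    .ofCore (GenBergman.sobolevCore hlam hk).toCore
  have hnorm : ∀ f : GenBergman.BergmanSpace d lam k,
      ‖f‖ ^ 2 = (GenBergman.sobolevInner f f).re := fun f =>
    norm_sq_eq_re_inner (𝕜 := ℂ) f
  have hcomplete : CompleteSpace (GenBergman.BergmanSpace d lam k) :=
    GenBergman.completeSpace_of_linearEquiv (GenBergman.coeffEquiv hlam hk)
      (GenBergman.sobolevInner_eq_inner hlam hk)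
  refine ⟨hcomplete, GenBergman.exists_bounded_operators hlam (fun f => f.toHol.1)
    (fun f g h => GenBergman.BergmanSpace.toHol_injective (Subtype.ext h))
    (GenBergman.coordMul hlam hk) (GenBergman.coordMul_apply hlam hk) ?_ ?_⟩
  · intro j f
    rw [hnorm, hnorm]
    exact GenBergman.re_sobolevInner_coordMul_le hlam hk j f
  · intro j m
    obtain ⟨f, h⟩ := GenBergman.exists_re_sobolevInner_coordMul_eq hlam hk j m
    exact ⟨f, by rwa [hnorm, hnorm]⟩
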